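/- Let $S_n$ be the set of permutations of $[n]=\{1,\dots,n\}$, $n\ge 0$, and for a pattern $\tau$ let $S_n(\tau)\subseteq S_n$ be the set of $\tau$-avoiding permutations. For $\sigma\in S_n$ let $\mathrm{crs}(\sigma)$ be the number of crossings of $\sigma$, i.e. of pairs $(i,j)$ with $i<j<\sigma(i)<\sigma(j)$ or $\sigma(i)<\sigma(j)\le i<j$. The Elizalde–Pak map $\Theta=\Phi^{-1}\circ\Psi$ is defined as follows. (1) Let $\sigma\in S_n(321)$ and let $(P,Q)$ be its pair of insertion and recording tableaux under the Robinson–Schensted–Knuth correspondence; they have at most two rows. The Dyck path $\Psi(\sigma)$ of semilength $n$ is the word in the up-step $u$ and the down-step $d$ obtained by writing, for $i=1,\dots,n$, the letter $u$ if $i$ is in the first row of $P$ and $d$ if $i$ is in the second row of $P$, and then, for $j=n,n-1,\dots,1$, the letter $u$ if $j$ is in the second row of $Q$ and $d$ if $j$ is in the first row of $Q$. (2) Let $D$ be a Dyck path of semilength $n$. Each up-step $u$ of $D$ is joined by a tunnel to exactly one down-step $d$ of $D$, namely the one for which $D=AuBdC$ with $B$ a Dyck path. From left to right, number the up-steps of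 $D$ by $n,n-1,\dots,1$ and the down-steps by $1,2,\dots,n$. Then $\pi=\Phi^{-1}(D)\in S_n$ is given by $\pi(n+1-i)=j$ if and only if the tunnel starting at the up-step numbered $n+1-i$ (the $i$-th up-step) ends at the down-step numbered $j$ (the $j$-th down-step). Theorem. For every $n\ge 0$, the map $\Theta$ is a well-defined bijection $S_n(321)\to S_n(132)$, and $\mathrm{crs}(\Theta(\sigma))=\mathrm{crs}(\sigma)$ for all $\sigma\in S_n(321)$. -/

import Mathlib

/-! Permutations of `[n] = {1, …, n}` are elements of `Equiv.Perm (Fin n)`: positions, values,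
tableau entries and the numbers attached to the steps of a path are all shifted by one, so that
they run through `0, …, n - 1`. -/

namespace ElizaldePak

/-- `σ` avoids the pattern `τ`: no subsequence `σ(i₁) … σ(iₖ)`, `i₁ < … < iₖ`, has the same relative
order as `τ(1) … τ(k)`. -/
def Avoids {k n : ℕ} (τ : Equiv.Perm (Fin k)) (σ : Equiv.Perm (Fin n)) : Prop :=
  ¬ ∃ f : Fin k ↪o Fin n, ∀ a b : Fin k, σ (f a) < σ (f b) ↔ τ a < τ b

/-- `S_n(τ)`, the set of `τ`-avoiding permutations of `[n]`. -/
def Av (n : ℕ) {k : ℕ} (τ : Equiv.Perm (Fin k)) : Type :=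
  {σ : Equiv.Perm (Fin n) // Avoids τ σ}

/-- The pattern `321`. -/
def p321 : Equiv.Perm (Fin 3) := Fin.revPerm

/-- The pattern `132`. -/
def p132 : Equiv.Perm (Fin 3) := Equiv.swap 1 2

/-- The number of crossings: pairs `(i, j)` with `i < j < σ(i) < σ(j)` or
`σ(i) < σ(j) ≤ i < j`. -/
def crs {n : ℕ} (σ : Equiv.Perm (Fin n)) : ℕ :=
  (Finset.univ.filter fun p : Fin n × Fin n =>
    (p.1 < p.2 ∧ p.2 < σ p.1 ∧ σ p.1 < σ p.2) ∨
    (σ p.1 < σ p.2 ∧ σ p.2 ≤ p.1 ∧ p.1 < p.2)).card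

/-- Row insertion of `x`: `x` replaces the leftmost entry larger than `x`, which is returned as the
bumped entry; if there is none, `x` is placed at the end of the row. -/
def rowInsert (x : ℕ) : List ℕ → List ℕ × Option ℕ
  | [] => ([x], none)
  | y :: ys =>
    if x < y then (x :: ys, some y)
    else (y :: (rowInsert x ys).1, (rowInsert x ys).2)

/-- One step of the Robinson–Schensted–Knuth algorithm. A pair `(P, Q)` of tableaux of the same
shape is stored as the list of pairs (row of `P`, row of `Q`), top row first; `x` is inserted into
`P`, and `i` is recorded in `Q` at the position of the new square. -/
def rskInsert (x i : ℕ) : List (List ℕ × List ℕ) → List (List ℕ × List ℕ)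
  | [] => [([x], [i])]
  | (p, q) :: T =>
    match rowInsert x p with
    | (p', none) => (p', q ++ [i]) :: T
    | (p', some y) => (p', q) :: rskInsert y i T

/-- The pair `(P, Q) = RSK(σ)`: insert `(i, σ(i))` for `i` from first to last. -/
def rsk {n : ℕ} (σ : Equiv.Perm (Fin n)) : List (List ℕ × List ℕ) :=
  (List.finRange n).foldl (fun T i => rskInsert (σ i) i T) []

/-- The first rows of `P` and of `Q`, where `(P, Q) = RSK(σ)`. -/
def firstRows {n : ℕ} (σ : Equiv.Perm (Fin n)) : List ℕ × List ℕ :=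
  (rsk σ).headD ([], [])

/-- The lattice path `Ψ(σ)`, for a `321`-avoiding `σ`. First half: for each number `i` in increasing
order, an up-step if `i` is in the first row of `P`, a down-step otherwise (that is, if `i` is in
the second row, as `P` and `Q` have at most two rows). Second half: for each number `j` in
decreasing order, a down-step if `j` is in the first row of `Q`, an up-step otherwise. -/
def psi {n : ℕ} (σ : Equiv.Perm (Fin n)) : List DyckStep :=
  (List.range n).map (fun i => if i ∈ (firstRows σ).1 then DyckStep.U else DyckStep.D) ++
  (List.range n).reverse.map (fun j => if j ∈ (firstRows σ).2 then DyckStep.D else DyckStep.U)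

/-- The path `w` is a Dyck path of semilength `n`. -/
def IsDyckPath (n : ℕ) (w : List DyckStep) : Prop :=
  ∃ p : DyckWord, p.toList = w ∧ p.semilength = n

/-- There is a tunnel of the path `w` from its up-step number `a` to its down-step number `b`, both
counted from the left and starting with `0`: that is, `w = A u B d C` with `B` a Dyck path, where
exactly `a` up-steps precede this `u` and exactly `b` down-steps precede this `d`. -/
def IsTunnel (w : List DyckStep) (a b : ℕ) : Prop :=
  ∃ (A : List DyckStep) (B : DyckWord) (C : List DyckStep),
    w = A ++ DyckStep.U :: (B.toList ++ DyckStep.D :: C) ∧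
    A.count DyckStep.U = a ∧
    (A ++ DyckStep.U :: B.toList).count DyckStep.D = b

/-- `π = Φ⁻¹(w)`: number the up-steps of `w` from left to right by `n, …, 1` and the down-steps by
`1, …, n`; then `π` sends the number of an up-step to the number of the down-step at which the
tunnel from this up-step ends. Such a `π` is determined by `w`. -/
def IsPhiInv {n : ℕ} (w : List DyckStep) (π : Equiv.Perm (Fin n)) : Prop :=
  ∀ a b : Fin n, π a.rev = b ↔ IsTunnel w a b

/-- `Θ = Φ⁻¹ ∘ Ψ`: for all `321`-avoiding `σ`, the path `Ψ(σ)` is a Dyck path of semilength `n`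
and `Θ(σ) = Φ⁻¹(Ψ(σ))`. At most one map `Θ` satisfies this. -/
def IsElizaldePakMap {n : ℕ} (Θ : Av n p321 → Av n p132) : Prop :=
  ∀ σ : Av n p321, IsDyckPath n (psi σ.1) ∧ IsPhiInv (psi σ.1) (Θ σ).1

/-- The conditions determine `Θ`. -/
theorem IsElizaldePakMap.unique {n : ℕ} {Θ Θ' : Av n p321 → Av n p132}
    (h : IsElizaldePakMap Θ) (h' : IsElizaldePakMap Θ') : Θ = Θ' := by
  funext σ
  refine Subtype.ext (Equiv.ext fun i => ?_)
  have h1 := ((h σ).2 i.rev ((Θ σ).1 i)).1 (by rw [Fin.rev_rev])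
  have h2 := ((h' σ).2 i.rev ((Θ σ).1 i)).2 h1
  rw [Fin.rev_rev] at h2
  exact h2.symm

end ElizaldePak

/-!
Read the steps of `psi σ` alternately from its two ends. The tunnels of the path are the entries of
`π = Φ⁻¹(psi σ)`; an excedance of `π` is a tunnel whose down-step is met before its up-step.

For every permutation `crs π + exc π = -∑ ε(i) ε(j)`, the sum being over the inversions of `π`,
where `ε` is `1` on excedances and `-1` elsewhere. The inversions of `π` are the pairs of disjoint
tunnels; sorting these pairs by the tunnel that is opened last makes the sum a sum over tunnels.
If `σ` avoids `321`, two excedances, or two non-excedances, never form an inversion, and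
`crs σ + exc σ` counts, for each arc `j → σ j`, the arcs cut by a point next to `j` or `σ j`.

The tunnels match the arcs of `σ`, excedances with excedances: at distance at least `j` from both
ends the height of `psi σ` is at least a monotone function of `j`, which is attained where a closing
step is expected and increases there, so each of the `n` steps that should close a tunnel does so.
The two sums then agree term by term, which is the equality of crossings.

The matching also recovers the excedance positions and the non-excedance values of `σ`, hence `σ`
itself, so `Θ` is injective. It is bijective because, as observed by Simion and Schmidt, a
`132`-avoiding permutation is determined by its left-to-right minima, and the left-to-right maxima
of any permutation are also those of a `321`-avoiding one.
-/

namespace ElizaldePak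

open Finset DyckStep

section Finite

variable {α β ι : Type*} [Fintype α] [Fintype β] [Fintype ι]

theorem card_filter_eq_add {p q r : α → Prop} [DecidablePred p] [DecidablePred q]
    [DecidablePred r] (h : ∀ a, p a ↔ q a ∨ r a) (hd : ∀ a, q a → ¬ r a) :
    #{a | p a} = #{a | q a} + #{a | r a} := by
  classical
  rw [← card_union_of_disjoint (disjoint_filter.2 fun a _ => hd a), ← filter_or]
  exact congrArg card (filter_congr fun a _ => h a)

theorem card_filter_prod (P : α → β → Prop) [∀ a b, Decidable (P a b)] :
    #{p : α × β | P p.1 p.2} = ∑ b, #{a | P a b} := by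
  simp only [card_filter, Fintype.sum_prod_type_right]

theorem card_filter_prod' (P : α → β → Prop) [∀ a b, Decidable (P a b)] :
    #{p : α × β | P p.1 p.2} = ∑ a, #{b | P a b} := by
  simp only [card_filter, Fintype.sum_prod_type]

theorem card_filter_val_lt_succ {f : α → ℕ} (hf : Function.Injective f) (p : α → Prop)
    [DecidablePred p] (t : α) :
    #{s | p s ∧ f s < f t + 1} = #{s | p s ∧ f s < f t} + if p t then 1 else 0 := by
  classical
  rw [card_filter_eq_add (q := fun s => p s ∧ f s < f t) (r := fun s => s = t ∧ p t)]
  · congr 1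
    split_ifs with ht
    · exact card_eq_one.2 ⟨t, by ext; simp [ht]⟩
    · simp [ht]
  · intro s
    rw [Nat.lt_succ_iff_lt_or_eq, hf.eq_iff]
    grind
  · grind

/-- Exactly one of `p` and `p.swap` satisfies `a p.1 < a p.2` for a pair `p` off the diagonal, so
that a symmetric sum does not see which injection `a` orders the pairs. -/
theorem sum_filter_lt_eq {M κ κ' : Type*} [AddCommMonoid M] [LinearOrder κ] [LinearOrder κ']
    {F : ι × ι → M} (hF : ∀ p, F p.swap = F p) {a : ι → κ} {b : ι → κ'}
    (ha : Function.Injective a) (hb : Function.Injective b) :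
    ∑ p with a p.1 < a p.2, F p = ∑ p with b p.1 < b p.2, F p := by
  refine sum_bij' (fun p _ => if b p.1 < b p.2 then p else p.swap)
    (fun p _ => if a p.1 < a p.2 then p else p.swap) ?_ ?_ ?_ ?_ ?_
  · rintro ⟨i, j⟩ hij
    simp only [mem_filter, mem_univ, true_and] at hij ⊢
    have : b i ≠ b j := fun e => hij.ne (congrArg a (hb e))
    grind
  · rintro ⟨i, j⟩ hij
    simp only [mem_filter, mem_univ, true_and] at hij ⊢
    have : a i ≠ a j := fun e => hij.ne (congrArg b (ha e))
    grind
  · simp only [mem_filter, mem_univ, true_and]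
    grind
  · simp only [mem_filter, mem_univ, true_and]
    grind
  · intro p _
    split_ifs
    exacts [rfl, (hF p).symm]

theorem card_filter_val_lt {n k : ℕ} (hk : k ≤ n) : #{i : Fin n | (i : ℕ) < k} = k := by
  rw [Fin.card_filter_val_lt, min_eq_right hk]

theorem card_filter_apply {p : α → Prop} [DecidablePred p] (σ : Equiv.Perm α) :
    #{i | p (σ i)} = #{i | p i} :=
  card_equiv σ (by simp)

end Finite

theorem funext_of_not_lt {α κ : Type*} [LinearOrder α] [WellFoundedLT α] [LinearOrder κ]
    {f g : α → κ}
    (h : ∀ t, (∀ s < t, f s = g s) → ¬ f t < g t ∧ ¬ g t < f t) : f = g := by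
  funext t
  induction t using WellFoundedLT.induction with
  | _ t ih => exact le_antisymm (not_lt.1 (h t ih).2) (not_lt.1 (h t ih).1)

section Counting

variable {n : ℕ}

/-- The number of arcs `i → π i` that pass from below `k` to `k` or above. -/
def cut (π : Equiv.Perm (Fin n)) (k : ℕ) : ℕ := #{i : Fin n | (i : ℕ) < k ∧ k ≤ π i}

/-- The number of inversions of `π` formed by two excedances or by two non-excedances. -/
def sameInv (π : Equiv.Perm (Fin n)) : ℕ :=
  #{p : Fin n × Fin n | p.1 < p.2 ∧ π p.2 < π p.1 ∧ (p.1 < π p.1 ↔ p.2 < π p.2)}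

/-- The number of inversions of `π` formed by an excedance and a non-excedance. -/
def mixedInv (π : Equiv.Perm (Fin n)) : ℕ :=
  #{p : Fin n × Fin n | p.1 < p.2 ∧ π p.2 < π p.1 ∧ ¬ (p.1 < π p.1 ↔ p.2 < π p.2)}

/-- The number of excedances of `π`. -/
def exc (π : Equiv.Perm (Fin n)) : ℕ := #{i : Fin n | i < π i}

/-- The total over all arcs `j → π j` of the number of arcs cut just after the position `j`, if `j`
is an excedance, and just before the value `π j`, if it is not. -/
def cutSum (π : Equiv.Perm (Fin n)) : ℕ :=
  ∑ j : Fin n, if j < π j then cut π (j + 1) else cut π (π j)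

/-- The sign of a position: `1` for an excedance, `-1` otherwise. -/
def sgn (π : Equiv.Perm (Fin n)) (i : Fin n) : ℤ := if i < π i then 1 else -1

theorem cut_eq_card_apply_lt (π : Equiv.Perm (Fin n)) (k : ℕ) :
    cut π k = #{i : Fin n | (π i : ℕ) < k ∧ k ≤ i} := by
  have hpos : #{i : Fin n | (i : ℕ) < k} =
      cut π k + #{i : Fin n | (i : ℕ) < k ∧ (π i : ℕ) < k} :=
    card_filter_eq_add (by grind) (by grind)
  have hval : #{i : Fin n | (π i : ℕ) < k} =
      #{i : Fin n | (π i : ℕ) < k ∧ k ≤ i} + #{i : Fin n | (i : ℕ) < k ∧ (π i : ℕ) < k} :=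
    card_filter_eq_add (by grind) (by grind)
  have := card_filter_apply (p := fun i : Fin n => (i : ℕ) < k) π
  omega

theorem cut_add (π : Equiv.Perm (Fin n)) {k : ℕ} (hk : k ≤ n) :
    cut π k + k = #{i : Fin n | i < π i ∧ (i : ℕ) < k} +
      #{i : Fin n | ¬ i < π i ∧ (π i : ℕ) < k} := by
  have hval : #{i : Fin n | (π i : ℕ) < k} =
      #{i : Fin n | (i < π i ∧ (π i : ℕ) < k)} + #{i : Fin n | ¬ i < π i ∧ (π i : ℕ) < k} :=
    card_filter_eq_add (by grind) (by grind)
  have hexc : #{i : Fin n | i < π i ∧ (i : ℕ) < k} =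
      cut π k + #{i : Fin n | i < π i ∧ (π i : ℕ) < k} :=
    card_filter_eq_add (by grind) (by grind)
  rw [card_filter_apply (p := fun i : Fin n => (i : ℕ) < k), card_filter_val_lt hk] at hval
  omega

theorem crs_eq_sum (π : Equiv.Perm (Fin n)) :
    crs π = ∑ j, if j < π j then #{i | i < j ∧ j < π i ∧ π i < π j}
      else #{i | π i < π j ∧ π j ≤ i ∧ i < j} := by
  rw [crs, card_filter_prod fun i j => (i < j ∧ j < π i ∧ π i < π j) ∨
    (π i < π j ∧ π j ≤ i ∧ i < j)]
  refine sum_congr rfl fun j _ => ?_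
  split_ifs <;> exact congrArg card (filter_congr (by grind))

theorem sameInv_eq_sum (π : Equiv.Perm (Fin n)) :
    sameInv π = ∑ j, if j < π j then #{i | i < j ∧ π j < π i}
      else #{i | j < i ∧ π i < π j} := by
  rw [sameInv, card_filter_eq_add
    (q := fun p => p.2 < π p.2 ∧ p.1 < p.2 ∧ π p.2 < π p.1)
    (r := fun p => ¬ p.1 < π p.1 ∧ p.1 < p.2 ∧ π p.2 < π p.1) (by grind) (by grind),
    card_filter_prod fun i j => j < π j ∧ i < j ∧ π j < π i,
    card_filter_prod' fun j i => ¬ j < π j ∧ j < i ∧ π i < π j, ← sum_add_distrib]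
  refine sum_congr rfl fun j _ => ?_
  split_ifs with hj <;> simp [hj]

theorem mixedInv_eq_sum (π : Equiv.Perm (Fin n)) :
    mixedInv π = ∑ j, if j < π j then #{i | π i ≤ j ∧ j < i}
      else #{i | i < π j ∧ π j < π i} := by
  rw [mixedInv, card_filter_eq_add
    (q := fun p => p.1 < π p.1 ∧ π p.2 ≤ p.1 ∧ p.1 < p.2)
    (r := fun p => ¬ p.2 < π p.2 ∧ p.1 < π p.2 ∧ π p.2 < π p.1) ?_ (by grind),
    card_filter_prod' fun j i => j < π j ∧ π i ≤ j ∧ j < i,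
    card_filter_prod fun i j => ¬ j < π j ∧ i < π j ∧ π j < π i, ← sum_add_distrib]
  · refine sum_congr rfl fun j _ => ?_
    split_ifs with hj <;> simp [hj]
  · rintro ⟨i, j⟩
    grind

theorem crs_add_sameInv_add_exc (π : Equiv.Perm (Fin n)) :
    crs π + sameInv π + exc π = cutSum π := by
  rw [crs_eq_sum, sameInv_eq_sum, exc, card_filter, cutSum, ← sum_add_distrib, ← sum_add_distrib]
  refine sum_congr rfl fun j _ => ?_
  have hinj (i : Fin n) : π i = π j ↔ i = j := π.injective.eq_iff
  split_ifs with hj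
  · have hcut : cut π (j + 1) = #{i | i < j ∧ j < π i} + #{i | i = j} :=
      card_filter_eq_add (by grind) (by grind)
    have hsplit : #{i | i < j ∧ j < π i} =
        #{i | i < j ∧ j < π i ∧ π i < π j} + #{i | i < j ∧ π j < π i} :=
      card_filter_eq_add (by grind) (by grind)
    have hself : #{i | i = j} = 1 := card_eq_one.2 ⟨j, by ext; simp⟩
    rw [hcut, hsplit, hself]
  · rw [cut_eq_card_apply_lt, add_zero]
    exact (card_filter_eq_add (by grind) (by grind)).symm

theorem mixedInv_eq_cutSum (π : Equiv.Perm (Fin n)) : mixedInv π = cutSum π := by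
  rw [mixedInv_eq_sum, cutSum]
  refine sum_congr rfl fun j _ => ?_
  split_ifs with hj
  · rw [cut_eq_card_apply_lt]
    exact congrArg card (filter_congr (by grind))
  · have hinj (i : Fin n) : π i = π j ↔ i = j := π.injective.eq_iff
    exact congrArg card (filter_congr (by grind))

theorem crs_add_exc_eq_neg_sum (π : Equiv.Perm (Fin n)) :
    (crs π + exc π : ℤ) =
      -∑ p : Fin n × Fin n with p.1 < p.2, if π p.2 < π p.1 then sgn π p.1 * sgn π p.2 else 0 := by
  have hcount : (crs π + exc π : ℤ) = mixedInv π - sameInv π := by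
    have := crs_add_sameInv_add_exc π
    rw [← mixedInv_eq_cutSum] at this
    omega
  rw [hcount, mixedInv, sameInv]
  rw [card_filter, card_filter, sum_filter, Nat.cast_sum, Nat.cast_sum, ← sum_sub_distrib,
    ← sum_neg_distrib]
  refine sum_congr rfl fun p _ => ?_
  unfold sgn
  split_ifs <;> grind

end Counting

section Avoidance

variable {n : ℕ} {σ σ' : Equiv.Perm (Fin n)}

theorem avoids_three_iff {τ : Equiv.Perm (Fin 3)} :
    Avoids τ σ ↔ ∀ a b c : Fin n, a < b → b < c →
      ¬ ∀ x y, σ (![a, b, c] x) < σ (![a, b, c] y) ↔ τ x < τ y := by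
  rw [Avoids, not_exists]
  constructor
  · intro h a b c hab hbc
    have hmono : StrictMono ![a, b, c] := by
      intro x y hxy
      have := hab.trans hbc
      fin_cases x <;> fin_cases y <;> simp_all
    exact h (OrderEmbedding.ofStrictMono _ hmono)
  · intro h f hf
    refine h (f 0) (f 1) (f 2) (f.strictMono (by decide)) (f.strictMono (by decide)) fun x y => ?_
    rw [← hf]
    fin_cases x <;> fin_cases y <;> rfl

theorem avoids_p321_iff :
    Avoids p321 σ ↔ ∀ a b c : Fin n, a < b → b < c → σ b < σ a → ¬ σ c < σ b := by
  rw [avoids_three_iff]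
  refine forall₃_congr fun a b c => forall₂_congr fun _ _ =>
    ⟨fun h hba hcb => h fun x y => ?_, fun h H => h ((H 1 0).2 (by decide)) ((H 2 1).2 (by decide))⟩
  have hca := hcb.trans hba
  fin_cases x <;> fin_cases y <;> simp [p321, hba, hcb, hca, hba.le, hcb.le, hca.le]

theorem avoids_p132_iff :
    Avoids p132 σ ↔ ∀ a b c : Fin n, a < b → b < c → σ a < σ c → ¬ σ c < σ b := by
  rw [avoids_three_iff]
  refine forall₃_congr fun a b c => forall₂_congr fun _ _ =>
    ⟨fun h hac hcb => h fun x y => ?_, fun h H => h ((H 0 2).2 (by decide)) ((H 2 1).2 (by decide))⟩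
  have hab := hac.trans hcb
  fin_cases x <;> fin_cases y <;>
    simp [p132, Equiv.swap_apply_def, hac, hcb, hab, hac.le, hcb.le, hab.le]

theorem Avoids.symm_p321 (h : Avoids p321 σ) : Avoids p321 σ.symm := by
  rw [avoids_p321_iff] at h ⊢
  intro a b c hab hbc hba hcb
  exact h _ _ _ hcb hba (by simpa) (by simpa)

theorem Avoids.lt_apply_of_inversion (h : Avoids p321 σ) {i t : Fin n} (hit : i < t)
    (hσ : σ t < σ i) : i < σ i := by
  have hsub : insert (σ t) ((Iio i).image σ) ⊆ Iio (σ i) := by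
    intro v hv
    simp only [mem_insert, mem_image, mem_Iio] at hv ⊢
    rcases hv with rfl | ⟨k, hk, rfl⟩
    · exact hσ
    · exact lt_of_le_of_ne (not_lt.1 fun hki => avoids_p321_iff.1 h k i t hk hit hki hσ)
        (σ.injective.ne hk.ne)
  have hnew : σ t ∉ (Iio i).image σ := by
    simp [σ.injective.eq_iff, hit.le]
  have hcard := card_le_card hsub
  rw [card_insert_of_notMem hnew, card_image_of_injective _ σ.injective, Fin.card_Iio,
    Fin.card_Iio] at hcard
  exact hcard

theorem Avoids.apply_lt_of_inversion (h : Avoids p321 σ) {i t : Fin n} (hit : i < t)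
    (hσ : σ t < σ i) : σ t < t := by
  simpa using h.symm_p321.lt_apply_of_inversion hσ (by simpa)

theorem Avoids.crs_add_exc (h : Avoids p321 σ) : crs σ + exc σ = cutSum σ := by
  have hsame : sameInv σ = 0 := by
    rw [sameInv, card_eq_zero, filter_eq_empty_iff]
    rintro ⟨i, t⟩ - ⟨hit, hσ, hiff⟩
    exact (h.apply_lt_of_inversion hit hσ).not_gt (hiff.1 (h.lt_apply_of_inversion hit hσ))
  rw [← crs_add_sameInv_add_exc, hsame, add_zero]

theorem Avoids.lt_of_apply_lt (h : Avoids p321 σ) {i j : Fin n} (hij : i < σ i ↔ j < σ j)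
    (hσ : σ i < σ j) : i < j := by
  refine lt_of_le_of_ne (not_lt.1 fun hji => ?_) fun e => hσ.ne (congrArg σ e)
  exact (h.apply_lt_of_inversion hji hσ).not_gt (hij.2 (h.lt_apply_of_inversion hji hσ))

theorem Avoids.not_apply_lt_of_eqOn_Iio (h' : Avoids p321 σ') (hpos : ∀ t, t < σ t ↔ t < σ' t)
    (hval : ∀ v, σ.symm v < v ↔ σ'.symm v < v) {t : Fin n} (ih : ∀ s < t, σ s = σ' s) :
    ¬ σ t < σ' t := by
  intro hlt
  have hs : σ' (σ'.symm (σ t)) = σ t := σ'.apply_symm_apply _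
  have hst : σ'.symm (σ t) < t := by
    refine h'.lt_of_apply_lt ?_ (by rwa [hs])
    rw [hs, ← hval, σ.symm_apply_apply, hpos]
  exact hst.ne (σ.injective ((ih _ hst).trans hs))

/-- Excedances and non-excedances are both increasing, so their positions and values suffice. -/
theorem Avoids.ext_excedance (h : Avoids p321 σ) (h' : Avoids p321 σ')
    (hpos : ∀ t, t < σ t ↔ t < σ' t) (hval : ∀ v, σ.symm v < v ↔ σ'.symm v < v) : σ = σ' :=
  DFunLike.coe_injective <| funext_of_not_lt fun _ ih =>
    ⟨h'.not_apply_lt_of_eqOn_Iio hpos hval ih,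
      h.not_apply_lt_of_eqOn_Iio (fun t => (hpos t).symm) (fun v => (hval v).symm)
        fun s hs => (ih s hs).symm⟩

end Avoidance

section Cardinality

variable {n : ℕ} {σ τ π π' : Equiv.Perm (Fin n)}

/-- The running maxima `max_{j ≤ i} σ j` and `max_{j ≤ i} τ j` agree for all `i`. The classes of
this relation carry the Simion–Schmidt comparison of `321`- and `132`-avoidance. -/
def SamePrefixMaxima (σ τ : Equiv.Perm (Fin n)) : Prop :=
  ∀ i v, (∃ j ≤ i, v ≤ σ j) ↔ ∃ j ≤ i, v ≤ τ j

theorem exists_le_swap_apply {a b c i v : Fin n} (hab : a < b) (hac : a < c) (hb : σ b < σ a)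
    (hc : σ c < σ a) (h : ∃ j ≤ i, v ≤ σ j) : ∃ j ≤ i, v ≤ σ (Equiv.swap b c j) := by
  obtain ⟨j, hj, hv⟩ := h
  have ha : Equiv.swap b c a = a := Equiv.swap_apply_of_ne_of_ne hab.ne hac.ne
  by_cases hjb : j = b
  · exact ⟨a, by grind, by grind⟩
  · by_cases hjc : j = c
    · exact ⟨a, by grind, by grind⟩
    · exact ⟨j, hj, by rwa [Equiv.swap_apply_of_ne_of_ne hjb hjc]⟩

theorem samePrefixMaxima_swap {a b c : Fin n} (hab : a < b) (hac : a < c) (hb : σ b < σ a)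
    (hc : σ c < σ a) : SamePrefixMaxima σ ((Equiv.swap b c).trans σ) := by
  refine fun i v => ⟨exists_le_swap_apply hab hac hb hc, fun h => ?_⟩
  have ha : Equiv.swap b c a = a := Equiv.swap_apply_of_ne_of_ne hab.ne hac.ne
  simpa using exists_le_swap_apply (σ := (Equiv.swap b c).trans σ) hab hac (by simpa [ha])
    (by simpa [ha]) h

/-- Sorting the last two entries of a `321` pattern keeps the running maxima and increases
`∑ i * σ i`, so a maximizer of this sum avoids `321`. -/
theorem exists_avoids_p321_samePrefixMaxima (τ : Equiv.Perm (Fin n)) :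
    ∃ σ : Equiv.Perm (Fin n), Avoids p321 σ ∧ SamePrefixMaxima τ σ := by
  classical
  have hne : ({σ | SamePrefixMaxima τ σ} : Finset (Equiv.Perm (Fin n))).Nonempty :=
    ⟨τ, mem_filter.2 ⟨mem_univ _, fun _ _ => Iff.rfl⟩⟩
  obtain ⟨σ, hσ, hmax⟩ := exists_max_image _
    (fun σ : Equiv.Perm (Fin n) => ∑ i : Fin n, (i : ℤ) * (σ i : ℕ)) hne
  simp only [mem_filter, mem_univ, true_and] at hσ hmax
  refine ⟨σ, avoids_p321_iff.2 fun a b c hab hbc hba hcb => ?_, hσ⟩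
  have hswap := samePrefixMaxima_swap hab (hab.trans hbc) hba (hcb.trans hba)
  have hle := hmax _ fun i v => (hσ i v).trans (hswap i v)
  rw [← sub_nonpos, ← sum_sub_distrib, Fintype.sum_eq_add b c hbc.ne] at hle
  · rw [Equiv.trans_apply, Equiv.trans_apply, Equiv.swap_apply_left, Equiv.swap_apply_right] at hle
    have hpos : (0 : ℤ) < ((c : ℤ) - b) * ((σ b : ℕ) - (σ c : ℕ)) :=
      mul_pos (by grind) (by grind)
    linarith
  · rintro j ⟨hjb, hjc⟩
    rw [Equiv.trans_apply, Equiv.swap_apply_of_ne_of_ne hjb hjc, sub_self]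

theorem Avoids.not_apply_lt_of_prefixMinima (hπ' : Avoids p132 π')
    (hmin : ∀ i v, (∃ j ≤ i, π j ≤ v) → ∃ j ≤ i, π' j ≤ v) {t : Fin n}
    (ih : ∀ s < t, π s = π' s) : ¬ π t < π' t := by
  intro hlt
  obtain ⟨a, hat, ha⟩ := hmin t (π t) ⟨t, le_rfl, le_rfl⟩
  have hat : a < t := lt_of_le_of_ne hat (by rintro rfl; exact hlt.not_ge ha)
  have ha : π' a < π t := lt_of_le_of_ne ha (ih a hat ▸ π.injective.ne hat.ne)
  have hs : π' (π'.symm (π t)) = π t := π'.apply_symm_apply _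
  have hts : t < π'.symm (π t) := by
    refine lt_of_le_of_ne (not_lt.1 fun hst => ?_) fun e => ?_
    · exact hst.ne (π.injective ((ih _ hst).trans hs))
    · exact hlt.ne (by rw [← hs, ← e])
  exact avoids_p132_iff.1 hπ' a t _ hat hts (by rwa [hs]) (by rwa [hs])

theorem Avoids.eq_of_samePrefixMaxima_rev (hπ : Avoids p132 π) (hπ' : Avoids p132 π')
    (h : SamePrefixMaxima (π.trans Fin.revPerm) (π'.trans Fin.revPerm)) : π = π' := by
  have hmin (i v : Fin n) : (∃ j ≤ i, π j ≤ v) ↔ ∃ j ≤ i, π' j ≤ v := by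
    simpa [Fin.rev_le_rev] using h i v.rev
  exact DFunLike.coe_injective <| funext_of_not_lt fun _ ih =>
    ⟨hπ'.not_apply_lt_of_prefixMinima (fun i v => (hmin i v).1) ih,
      hπ.not_apply_lt_of_prefixMinima (fun i v => (hmin i v).2) fun s hs => (ih s hs).symm⟩

instance (n : ℕ) {k : ℕ} (τ : Equiv.Perm (Fin k)) : Finite (Av n τ) :=
  inferInstanceAs (Finite {σ : Equiv.Perm (Fin n) // Avoids τ σ})

theorem card_av_p132_le (n : ℕ) : Nat.card (Av n p132) ≤ Nat.card (Av n p321) := by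
  choose f hf hmax using fun π : Av n p132 =>
    exists_avoids_p321_samePrefixMaxima (π.1.trans Fin.revPerm)
  refine Nat.card_le_card_of_injective (fun π => (⟨f π, hf π⟩ : Av n p321)) fun π π' hπ => ?_
  have he : f π = f π' := congrArg Subtype.val hπ
  exact Subtype.ext (π.2.eq_of_samePrefixMaxima_rev π'.2 fun i v =>
    (hmax π i v).trans (he ▸ (hmax π' i v).symm))

end Cardinality

section Insertion

theorem rowInsert_snd (x : ℕ) (p : List ℕ) : (rowInsert x p).2 = p.find? (x < ·) := by
  induction p with
  | nil => rfl
  | cons y p ih => by_cases h : x < y <;> simp [rowInsert, h, ih]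

theorem mem_rowInsert_fst {x z : ℕ} {p : List ℕ} (hp : p.Nodup) :
    z ∈ (rowInsert x p).1 ↔ z = x ∨ z ∈ p ∧ (rowInsert x p).2 ≠ some z := by
  induction p with
  | nil => simp [rowInsert]
  | cons y p ih =>
    obtain ⟨hy, hp⟩ := List.nodup_cons.1 hp
    by_cases h : x < y
    · simp only [rowInsert, if_pos h, List.mem_cons]
      grind
    · have hne : (rowInsert x p).2 ≠ some y := fun e =>
        hy (List.mem_of_find?_eq_some ((rowInsert_snd x p).symm.trans e))
      simp only [rowInsert, if_neg h, List.mem_cons, ih hp]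
      grind

theorem pairwise_lt_rowInsert_fst {x : ℕ} {p : List ℕ} (hp : p.Pairwise (· < ·)) (hx : x ∉ p) :
    (rowInsert x p).1.Pairwise (· < ·) := by
  induction p with
  | nil => simp [rowInsert]
  | cons y p ih =>
    obtain ⟨hy, hp⟩ := List.pairwise_cons.1 hp
    by_cases h : x < y
    · simp only [rowInsert, if_pos h]
      exact List.pairwise_cons.2 ⟨fun z hz => h.trans (hy z hz), hp⟩
    · simp only [rowInsert, if_neg h]
      refine List.pairwise_cons.2 ⟨fun z hz => ?_, ih hp (by grind)⟩
      rcases (mem_rowInsert_fst hp.nodup).1 hz with rfl | ⟨hz, -⟩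
      · grind
      · exact hy z hz

theorem exists_rowInsert_snd_le {x z : ℕ} {p : List ℕ} (hp : p.Pairwise (· < ·)) (hz : z ∈ p)
    (hxz : x < z) : ∃ y ≤ z, (rowInsert x p).2 = some y := by
  induction p with
  | nil => cases hz
  | cons y p ih =>
    obtain ⟨hy, hp⟩ := List.pairwise_cons.1 hp
    rw [rowInsert_snd, List.find?_cons] at *
    grind

/-- The effect of one step of the Robinson–Schensted–Knuth algorithm on the first rows. -/
def firstRowInsert (s : List ℕ × List ℕ) (x i : ℕ) : List ℕ × List ℕ :=
  ((rowInsert x s.1).1, if (rowInsert x s.1).2 = none then s.2 ++ [i] else s.2)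

theorem headD_rskInsert (x i : ℕ) (T : List (List ℕ × List ℕ)) :
    (rskInsert x i T).headD ([], []) = firstRowInsert (T.headD ([], [])) x i := by
  rcases T with _ | ⟨⟨p, q⟩, T⟩
  · simp [rskInsert, firstRowInsert, rowInsert]
  · rcases h : rowInsert x p with ⟨p', _ | y⟩ <;> simp [rskInsert, firstRowInsert, h]

variable {n : ℕ} {σ : Equiv.Perm (Fin n)}

/-- The first rows of the two tableaux after `k` insertions. -/
def partialRows (σ : Equiv.Perm (Fin n)) (k : ℕ) : List ℕ × List ℕ :=
  ((List.finRange n).take k).foldl (fun s i => firstRowInsert s (σ i) i) ([], [])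

theorem firstRows_eq_partialRows (σ : Equiv.Perm (Fin n)) : firstRows σ = partialRows σ n := by
  have hfold (l : List (Fin n)) (T : List (List ℕ × List ℕ)) :
      (l.foldl (fun T i => rskInsert (σ i) i T) T).headD ([], []) =
        l.foldl (fun s i => firstRowInsert s (σ i) i) (T.headD ([], [])) := by
    induction l generalizing T with
    | nil => rfl
    | cons a l ih => rw [List.foldl_cons, List.foldl_cons, ih, headD_rskInsert]
  rw [firstRows, rsk, hfold, partialRows, List.take_of_length_le (by simp)]
  rfl

theorem partialRows_succ (σ : Equiv.Perm (Fin n)) (t : Fin n) :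
    partialRows σ (t + 1) = firstRowInsert (partialRows σ t) (σ t) t := by
  rw [partialRows, List.take_add_one, List.foldl_append, ← partialRows]
  simp

/-- The insertion of `σ s` bumps the entry `σ r` out of the first row. -/
def Bumps (σ : Equiv.Perm (Fin n)) (s r : Fin n) : Prop :=
  (rowInsert (σ s) (partialRows σ s).1).2 = some (σ r : ℕ)

theorem partialRows_fst_pairwise_and_entries (σ : Equiv.Perm (Fin n)) {k : ℕ} (hk : k ≤ n) :
    (partialRows σ k).1.Pairwise (· < ·) ∧
      ∀ v ∈ (partialRows σ k).1, ∃ r : Fin n, (r : ℕ) < k ∧ (σ r : ℕ) = v := by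
  induction k with
  | zero => simp [partialRows]
  | succ k ih =>
    obtain ⟨hsort, hent⟩ := ih (by omega)
    obtain ⟨t, rfl⟩ : ∃ t : Fin n, (t : ℕ) = k := ⟨⟨k, hk⟩, rfl⟩
    rw [partialRows_succ]
    refine ⟨pairwise_lt_rowInsert_fst hsort fun ht => ?_, fun v hv => ?_⟩
    · obtain ⟨r, hr, he⟩ := hent _ ht
      have : r = t := σ.injective (Fin.ext he)
      exact hr.ne (congrArg Fin.val this)
    · rcases (mem_rowInsert_fst hsort.nodup).1 hv with rfl | ⟨hv, -⟩
      · exact ⟨t, (t : ℕ).lt_succ_self, rfl⟩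
      · obtain ⟨r, hr, he⟩ := hent v hv
        exact ⟨r, hr.trans (t : ℕ).lt_succ_self, he⟩

theorem pairwise_lt_partialRows_fst (σ : Equiv.Perm (Fin n)) {k : ℕ} (hk : k ≤ n) :
    (partialRows σ k).1.Pairwise (· < ·) :=
  (partialRows_fst_pairwise_and_entries σ hk).1

theorem exists_apply_eq_of_mem_partialRows_fst {k v : ℕ} (hk : k ≤ n)
    (hv : v ∈ (partialRows σ k).1) : ∃ r : Fin n, (r : ℕ) < k ∧ (σ r : ℕ) = v :=
  (partialRows_fst_pairwise_and_entries σ hk).2 v hv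

namespace Bumps

variable {r s t : Fin n}

theorem mem_partialRows (h : Bumps σ s r) : (σ r : ℕ) ∈ (partialRows σ s).1 :=
  List.mem_of_find?_eq_some ((rowInsert_snd _ _).symm.trans h)

theorem lt (h : Bumps σ s r) : r < s := by
  obtain ⟨q, hq, he⟩ := exists_apply_eq_of_mem_partialRows_fst s.2.le h.mem_partialRows
  rwa [σ.injective (Fin.ext he)] at hq

theorem apply_lt (h : Bumps σ s r) : σ s < σ r := by
  rw [Bumps, rowInsert_snd] at h
  simpa using List.find?_some h

theorem right_unique (h : Bumps σ s r) (h' : Bumps σ s t) : r = t :=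
  σ.injective (Fin.ext (Option.some_injective _ (h.symm.trans h')))

end Bumps

theorem rowInsert_snd_eq_none_iff (σ : Equiv.Perm (Fin n)) (s : Fin n) :
    (rowInsert (σ s) (partialRows σ s).1).2 = none ↔ ∀ r, ¬ Bumps σ s r := by
  refine ⟨fun h r hr => by simp [Bumps, h] at hr, fun h => ?_⟩
  by_contra hne
  obtain ⟨v, hv⟩ := Option.ne_none_iff_exists'.1 hne
  have hmem := List.mem_of_find?_eq_some ((rowInsert_snd _ _).symm.trans hv)
  obtain ⟨r, -, rfl⟩ := exists_apply_eq_of_mem_partialRows_fst s.2.le hmem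
  exact h r hv

theorem mem_partialRows_fst_iff {k : ℕ} (hk : k ≤ n) (r : Fin n) :
    (σ r : ℕ) ∈ (partialRows σ k).1 ↔ (r : ℕ) < k ∧ ∀ s : Fin n, (s : ℕ) < k → ¬ Bumps σ s r := by
  induction k with
  | zero => simp [partialRows]
  | succ k ih =>
    obtain ⟨t, rfl⟩ : ∃ t : Fin n, (t : ℕ) = k := ⟨⟨k, hk⟩, rfl⟩
    have hlt (s : Fin n) : s < (t : ℕ) + 1 ↔ s < t ∨ s = t := by
      rw [Nat.lt_succ_iff_lt_or_eq, Fin.lt_def, Fin.ext_iff]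
    have hsort := pairwise_lt_partialRows_fst σ t.2.le
    have hlast (s : Fin n) (hs : Bumps σ s t) : ¬ s ≤ t := hs.lt.not_ge
    rw [partialRows_succ, firstRowInsert,
      mem_rowInsert_fst hsort.nodup, ih (by omega), Fin.val_inj, σ.injective.eq_iff]
    change _ ∨ _ ∧ ¬ Bumps σ t r ↔ _
    grind

theorem mem_partialRows_snd_iff {k : ℕ} (hk : k ≤ n) (t : Fin n) :
    (t : ℕ) ∈ (partialRows σ k).2 ↔ (t : ℕ) < k ∧ ∀ r, ¬ Bumps σ t r := by
  induction k with
  | zero => simp [partialRows]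
  | succ k ih =>
    obtain ⟨s, rfl⟩ : ∃ s : Fin n, (s : ℕ) = k := ⟨⟨k, hk⟩, rfl⟩
    have hnone := rowInsert_snd_eq_none_iff σ s
    have hinj : (t : ℕ) = s ↔ t = s := Fin.val_inj
    rw [partialRows_succ, firstRowInsert]
    split_ifs with h <;> grind

theorem mem_firstRows_fst_iff (r : Fin n) :
    (σ r : ℕ) ∈ (firstRows σ).1 ↔ ∀ s, ¬ Bumps σ s r := by
  simp [firstRows_eq_partialRows, mem_partialRows_fst_iff le_rfl]

theorem mem_firstRows_snd_iff (t : Fin n) :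
    (t : ℕ) ∈ (firstRows σ).2 ↔ ∀ r, ¬ Bumps σ t r := by
  simp [firstRows_eq_partialRows, mem_partialRows_snd_iff le_rfl]

theorem Bumps.left_unique {r s t : Fin n} (hs : Bumps σ s r) (ht : Bumps σ t r) : s = t := by
  by_contra hne
  wlog hst : s < t generalizing s t
  · exact this ht hs (Ne.symm hne) (lt_of_le_of_ne (not_lt.1 hst) (Ne.symm hne))
  exact ((mem_partialRows_fst_iff t.2.le r).1 ht.mem_partialRows).2 s hst hs

/-- Of the entries larger than `σ s` still in the row, the smallest is bumped. -/
theorem exists_bumps_le {r s : Fin n} (hrs : r < s) (hσ : σ s < σ r)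
    (hr : ∀ s' < s, ¬ Bumps σ s' r) : ∃ q, σ q ≤ σ r ∧ Bumps σ s q := by
  have hmem := (mem_partialRows_fst_iff s.2.le r).2 ⟨hrs, hr⟩
  obtain ⟨v, hv, hb⟩ := exists_rowInsert_snd_le (pairwise_lt_partialRows_fst σ s.2.le) hmem hσ
  have hmem := List.mem_of_find?_eq_some ((rowInsert_snd _ _).symm.trans hb)
  obtain ⟨q, -, rfl⟩ := exists_apply_eq_of_mem_partialRows_fst s.2.le hmem
  exact ⟨q, hv, hb⟩

end Insertion

section Heights

variable {n : ℕ} {σ : Equiv.Perm (Fin n)} {r s t : Fin n} {j k : ℕ}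

/-- The value `σ r` is bumped from the first row: it ends in the second row of `P`. -/
def IsBumped (σ : Equiv.Perm (Fin n)) (r : Fin n) : Prop := ∃ s, Bumps σ s r

/-- The insertion at time `s` bumps a value: `s` ends in the second row of `Q`. -/
def IsBumper (σ : Equiv.Perm (Fin n)) (s : Fin n) : Prop := ∃ r, Bumps σ s r

instance (s r : Fin n) : Decidable (Bumps σ s r) :=
  inferInstanceAs (Decidable (_ = _))

instance : DecidablePred (IsBumped σ) := fun r => inferInstanceAs (Decidable (∃ s, Bumps σ s r))

instance : DecidablePred (IsBumper σ) := fun s => inferInstanceAs (Decidable (∃ r, Bumps σ s r))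

theorem Avoids.lt_apply_of_isBumped (h : Avoids p321 σ) (hr : IsBumped σ r) : r < σ r :=
  let ⟨_, hs⟩ := hr
  h.lt_apply_of_inversion hs.lt hs.apply_lt

theorem Avoids.apply_lt_of_isBumper (h : Avoids p321 σ) (hs : IsBumper σ s) : σ s < s :=
  let ⟨_, hr⟩ := hs
  h.apply_lt_of_inversion hr.lt hr.apply_lt

theorem card_le_card_of_bumps {p q : Fin n → Prop} [DecidablePred p] [DecidablePred q]
    (h : ∀ r, p r → ∃ s, q s ∧ Bumps σ s r) : #{r | p r} ≤ #{s | q s} :=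
  card_le_card_of_forall_subsingleton (fun r s => Bumps σ s r) (by simpa using h)
    fun _ _ _ hr _ hr' => hr.2.right_unique hr'.2

theorem card_le_card_of_bumps' {p q : Fin n → Prop} [DecidablePred p] [DecidablePred q]
    (h : ∀ s, q s → ∃ r, p r ∧ Bumps σ s r) : #{s | q s} ≤ #{r | p r} :=
  card_le_card_of_forall_subsingleton (Bumps σ) (by simpa using h)
    fun _ _ _ hs _ hs' => hs.2.left_unique hs'.2

/-- The height of `psi σ` after its first `j` steps. -/
def heightL (σ : Equiv.Perm (Fin n)) (j : ℕ) : ℤ :=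
  j - 2 * #{r : Fin n | IsBumped σ r ∧ (σ r : ℕ) < j}

/-- The height of `psi σ` before its last `j` steps. -/
def heightR (σ : Equiv.Perm (Fin n)) (j : ℕ) : ℤ :=
  j - 2 * #{s : Fin n | IsBumper σ s ∧ (s : ℕ) < j}

/-- A lower bound for `heightL` and `heightR` that is attained by `heightL` at the value of each
unbumped excedance and by `heightR` at each non-excedance that is not a bumper, and increases
after each of them. -/
def floorHeight (σ : Equiv.Perm (Fin n)) (j : ℕ) : ℕ :=
  #{t : Fin n | (t < σ t ∧ ¬ IsBumped σ t) ∧ (σ t : ℕ) < j} +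
  #{t : Fin n | (¬ t < σ t ∧ ¬ IsBumper σ t) ∧ (t : ℕ) < j}

theorem heightL_succ (t : Fin n) :
    heightL σ (σ t + 1) = heightL σ (σ t) + if IsBumped σ t then -1 else 1 := by
  rw [heightL, heightL, card_filter_val_lt_succ (f := fun s => (σ s : ℕ))
    (Fin.val_injective.comp σ.injective)]
  split_ifs <;> push_cast <;> ring

theorem heightR_succ (t : Fin n) :
    heightR σ (t + 1) = heightR σ t + if IsBumper σ t then -1 else 1 := by
  rw [heightR, heightR, card_filter_val_lt_succ Fin.val_injective]
  split_ifs <;> push_cast <;> ring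

theorem heightR_top (σ : Equiv.Perm (Fin n)) : heightR σ n = heightL σ n := by
  have hcard : #{r | IsBumped σ r} = #{s | IsBumper σ s} :=
    le_antisymm (card_le_card_of_bumps fun r ⟨s, hs⟩ => ⟨s, ⟨r, hs⟩, hs⟩)
      (card_le_card_of_bumps' fun s ⟨r, hr⟩ => ⟨r, ⟨s, hr⟩, hr⟩)
  simp [heightR, heightL, hcard]

theorem heightL_eq (h : Avoids p321 σ) (hj : j ≤ n) :
    heightL σ j = floorHeight σ j +
      #{s : Fin n | ¬ s < σ s ∧ (σ s : ℕ) < j ∧ (IsBumper σ s ∨ j ≤ s)} -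
      #{r : Fin n | IsBumped σ r ∧ (σ r : ℕ) < j} := by
  have hval : #{t : Fin n | (σ t : ℕ) < j} =
      #{t : Fin n | t < σ t ∧ (σ t : ℕ) < j} + #{t : Fin n | ¬ t < σ t ∧ (σ t : ℕ) < j} :=
    card_filter_eq_add (by grind) (by grind)
  have hexc : #{t : Fin n | t < σ t ∧ (σ t : ℕ) < j} =
      #{r : Fin n | IsBumped σ r ∧ (σ r : ℕ) < j} +
      #{t : Fin n | (t < σ t ∧ ¬ IsBumped σ t) ∧ (σ t : ℕ) < j} :=
    card_filter_eq_add (by grind [h.lt_apply_of_isBumped]) (by grind)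
  have hnonexc : #{t : Fin n | ¬ t < σ t ∧ (σ t : ℕ) < j} =
      #{s : Fin n | ¬ s < σ s ∧ (σ s : ℕ) < j ∧ (IsBumper σ s ∨ j ≤ s)} +
      #{t : Fin n | (¬ t < σ t ∧ ¬ IsBumper σ t) ∧ (t : ℕ) < j} :=
    card_filter_eq_add (by grind) (by grind)
  rw [card_filter_apply (p := fun i : Fin n => (i : ℕ) < j), card_filter_val_lt hj] at hval
  rw [heightL, floorHeight]
  omega

theorem heightR_eq (h : Avoids p321 σ) (hj : j ≤ n) :
    heightR σ j = floorHeight σ j +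
      #{r : Fin n | r < σ r ∧ (r : ℕ) < j ∧ (IsBumped σ r ∨ j ≤ σ r)} -
      #{s : Fin n | IsBumper σ s ∧ (s : ℕ) < j} := by
  have hpos : #{t : Fin n | (t : ℕ) < j} =
      #{t : Fin n | t < σ t ∧ (t : ℕ) < j} + #{t : Fin n | ¬ t < σ t ∧ (t : ℕ) < j} :=
    card_filter_eq_add (by grind) (by grind)
  have hexc : #{t : Fin n | t < σ t ∧ (t : ℕ) < j} =
      #{r : Fin n | r < σ r ∧ (r : ℕ) < j ∧ (IsBumped σ r ∨ j ≤ σ r)} +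
      #{t : Fin n | (t < σ t ∧ ¬ IsBumped σ t) ∧ (σ t : ℕ) < j} :=
    card_filter_eq_add (by grind) (by grind)
  have hnonexc : #{t : Fin n | ¬ t < σ t ∧ (t : ℕ) < j} =
      #{s : Fin n | IsBumper σ s ∧ (s : ℕ) < j} +
      #{t : Fin n | (¬ t < σ t ∧ ¬ IsBumper σ t) ∧ (t : ℕ) < j} :=
    card_filter_eq_add (fun s => by have := h.apply_lt_of_isBumper (s := s); grind) (by grind)
  rw [card_filter_val_lt hj] at hpos
  rw [heightR, floorHeight]
  omega

theorem floorHeight_le_heightL (h : Avoids p321 σ) (hj : j ≤ n) :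
    floorHeight σ j ≤ heightL σ j := by
  have hle : #{r : Fin n | IsBumped σ r ∧ (σ r : ℕ) < j} ≤
      #{s : Fin n | ¬ s < σ s ∧ (σ s : ℕ) < j ∧ (IsBumper σ s ∨ j ≤ s)} :=
    card_le_card_of_bumps fun r ⟨⟨s, hs⟩, hr⟩ => ⟨s, ⟨(h.apply_lt_of_isBumper ⟨r, hs⟩).not_gt,
      lt_trans hs.apply_lt hr, .inl ⟨r, hs⟩⟩, hs⟩
  rw [heightL_eq h hj]
  omega

theorem card_isBumper_le (h : Avoids p321 σ) (j : ℕ) :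
    #{s : Fin n | IsBumper σ s ∧ (s : ℕ) < j} ≤
      #{r : Fin n | r < σ r ∧ (r : ℕ) < j ∧ IsBumped σ r} :=
  card_le_card_of_bumps' fun s ⟨⟨r, hr⟩, hs⟩ => ⟨r, ⟨h.lt_apply_of_isBumped ⟨s, hr⟩,
    lt_trans hr.lt hs, ⟨s, hr⟩⟩, hr⟩

theorem floorHeight_le_heightR (h : Avoids p321 σ) (hj : j ≤ n) :
    floorHeight σ j ≤ heightR σ j := by
  have hle : #{r : Fin n | r < σ r ∧ (r : ℕ) < j ∧ IsBumped σ r} ≤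
      #{r : Fin n | r < σ r ∧ (r : ℕ) < j ∧ (IsBumped σ r ∨ j ≤ σ r)} :=
    card_le_card (monotone_filter_right _ (by grind))
  have := card_isBumper_le h j
  rw [heightR_eq h hj]
  omega

theorem floorHeight_lt_heightR (h : Avoids p321 σ) (ht : t < σ t) (hb : ¬ IsBumped σ t) :
    floorHeight σ (σ t) < heightR σ (σ t) := by
  have hlt : #{r : Fin n | r < σ r ∧ (r : ℕ) < σ t ∧ IsBumped σ r} <
      #{r : Fin n | r < σ r ∧ (r : ℕ) < σ t ∧ (IsBumped σ r ∨ (σ t : ℕ) ≤ σ r)} :=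
    card_lt_card ⟨monotone_filter_right _ (by grind), fun hsub => hb
      (mem_filter.1 (hsub (mem_filter.2 ⟨mem_univ t, ht, ht, .inr le_rfl⟩))).2.2.2⟩
  have := card_isBumper_le h (σ t)
  rw [heightR_eq h (σ t).2.le]
  omega

theorem heightL_eq_floorHeight (h : Avoids p321 σ) (ht : t < σ t) (hb : ¬ IsBumped σ t) :
    heightL σ (σ t) = floorHeight σ (σ t) := by
  refine le_antisymm ?_ (floorHeight_le_heightL h (σ t).2.le)
  have hle : #{s : Fin n | ¬ s < σ s ∧ (σ s : ℕ) < σ t ∧ (IsBumper σ s ∨ (σ t : ℕ) ≤ s)} ≤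
      #{r : Fin n | IsBumped σ r ∧ (σ r : ℕ) < σ t} := by
    refine card_le_card_of_bumps' (σ := σ) fun s ⟨_, hst, hs⟩ => ?_
    rcases lt_or_ge t s with hts | hts
    · obtain ⟨q, hq, hsq⟩ := exists_bumps_le hts hst fun s' _ hs' => hb ⟨s', hs'⟩
      have hqt : q ≠ t := fun e => hb ⟨s, e ▸ hsq⟩
      exact ⟨q, ⟨⟨s, hsq⟩, hq.lt_of_ne (σ.injective.ne hqt)⟩, hsq⟩
    · obtain ⟨q, hsq⟩ := hs.resolve_right (by grind)
      refine ⟨q, ⟨⟨s, hsq⟩, not_le.1 fun hle => ?_⟩, hsq⟩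
      have hqt : q < t := hsq.lt.trans_le hts
      exact hqt.not_gt (h.lt_of_apply_lt
        (iff_of_true ht (h.lt_apply_of_isBumped ⟨s, hsq⟩))
        (lt_of_le_of_ne hle (σ.injective.ne hqt.ne')))
  rw [heightL_eq h (σ t).2.le]
  omega

theorem heightR_eq_floorHeight (h : Avoids p321 σ) (ht : ¬ t < σ t) (hb : ¬ IsBumper σ t) :
    heightR σ t = floorHeight σ t := by
  refine le_antisymm ?_ (floorHeight_le_heightR h t.2.le)
  have bumped_before : ∀ r < t, σ t < σ r → ∃ s < t, Bumps σ s r := by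
    intro r hrt hσ
    by_contra! hr
    obtain ⟨q, -, hq⟩ := exists_bumps_le hrt hσ hr
    exact hb ⟨q, hq⟩
  have hle : #{r : Fin n | r < σ r ∧ (r : ℕ) < t ∧ (IsBumped σ r ∨ (t : ℕ) ≤ σ r)} ≤
      #{s : Fin n | IsBumper σ s ∧ (s : ℕ) < t} := by
    refine card_le_card_of_bumps (σ := σ) fun r ⟨_, hrt, hr⟩ => ?_
    rcases lt_or_gt_of_ne (σ.injective.ne (Fin.ne_of_lt hrt)) with hσ | hσ
    · obtain ⟨s, hs⟩ := hr.resolve_right (by grind)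
      exact ⟨s, ⟨⟨r, hs⟩, h.lt_of_apply_lt
        (iff_of_false (h.apply_lt_of_isBumper ⟨r, hs⟩).not_gt ht) (hs.apply_lt.trans hσ)⟩, hs⟩
    · obtain ⟨s, hst, hs⟩ := bumped_before r hrt hσ
      exact ⟨s, ⟨⟨r, hs⟩, hst⟩, hs⟩
  rw [heightR_eq h t.2.le]
  omega

theorem floorHeight_mono (σ : Equiv.Perm (Fin n)) : Monotone (floorHeight σ) := fun j k hjk =>
  add_le_add (card_le_card (monotone_filter_right _ (by grind)))
    (card_le_card (monotone_filter_right _ (by grind)))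

theorem floorHeight_apply_succ (ht : t < σ t) (hb : ¬ IsBumped σ t) :
    floorHeight σ (σ t) < floorHeight σ (σ t + 1) := by
  refine add_lt_add_of_lt_of_le ?_ (card_le_card (monotone_filter_right _ (by grind)))
  rw [card_filter_val_lt_succ (f := fun s => (σ s : ℕ)) (Fin.val_injective.comp σ.injective)]
  simp [ht, hb]

theorem floorHeight_succ (ht : ¬ t < σ t) (hb : ¬ IsBumper σ t) :
    floorHeight σ t < floorHeight σ (t + 1) := by
  refine add_lt_add_of_le_of_lt (card_le_card (monotone_filter_right _ (by grind))) ?_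
  rw [card_filter_val_lt_succ Fin.val_injective]
  simp only [ht, hb]
  simp

end Heights

section Tunnels

variable {w : List DyckStep} {s s' : DyckStep} {a b n x y x' y' j k : ℕ}

theorem count_U_add_count_D (w : List DyckStep) : w.count U + w.count D = w.length := by
  induction w with
  | nil => rfl
  | cons s w ih => cases s <;> simp <;> omega

theorem count_take_add (h : k ≤ w.length) : (w.take k).count U + (w.take k).count D = k := by
  rw [count_U_add_count_D, List.length_take, min_eq_left h]

theorem count_take_mono (w : List DyckStep) (s : DyckStep) (h : j ≤ k) :
    (w.take j).count s ≤ (w.take k).count s :=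
  (List.take_sublist_take_left h).count_le s

theorem count_take_succ_self (h : w[k]? = some s) :
    (w.take (k + 1)).count s = (w.take k).count s + 1 := by
  simp [List.take_add_one, h]

theorem count_take_succ_of_ne (h : w[k]? = some s) (hs : s ≠ s') :
    (w.take (k + 1)).count s' = (w.take k).count s' := by
  simp [List.take_add_one, h, hs]

theorem count_take_lt_iff (h : w[j]? = some s) :
    (w.take j).count s < (w.take k).count s ↔ j < k := by
  refine ⟨fun hlt => not_le.1 fun hkj => (count_take_mono w s hkj).not_gt hlt, fun hjk => ?_⟩
  have := count_take_mono w s (Nat.succ_le_of_lt hjk)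
  rw [Nat.succ_eq_add_one, count_take_succ_self h] at this
  omega

theorem eq_of_count_take_eq (hj : w[j]? = some s) (hk : w[k]? = some s)
    (h : (w.take j).count s = (w.take k).count s) : j = k :=
  le_antisymm (not_lt.1 fun hkj => ((count_take_lt_iff hk).2 hkj).ne' h)
    (not_lt.1 fun hjk => ((count_take_lt_iff hj).2 hjk).ne h)

theorem exists_count_take_eq (h : a < w.count s) :
    ∃ x, w[x]? = some s ∧ (w.take x).count s = a := by
  induction w generalizing a with
  | nil => simp at h
  | cons t w ih =>
    rw [List.count_cons] at h
    by_cases hts : t = s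
    · rcases a with _ | a
      · exact ⟨0, by simp [hts]⟩
      · obtain ⟨x, hx, hc⟩ := ih (a := a) (by simpa [hts] using h)
        exact ⟨x + 1, by simpa using hx, by simpa [hts] using hc⟩
    · obtain ⟨x, hx, hc⟩ := ih (a := a) (by simpa [hts] using h)
      exact ⟨x + 1, by simpa using hx, by simpa [hts] using hc⟩

/-- The height of the path `w` after `k` steps. -/
def height (w : List DyckStep) (k : ℕ) : ℤ := (w.take k).count U - (w.take k).count D

theorem height_length (w : List DyckStep) : height w w.length = w.count U - w.count D := by
  rw [height, List.take_length]

theorem height_add (w : List DyckStep) (j k : ℕ) :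
    height w (j + k) = height w j + height (w.drop j) k := by
  simp only [height, List.take_add, List.count_append]
  push_cast
  ring

theorem height_append_of_le {u v : List DyckStep} (h : k ≤ u.length) :
    height (u ++ v) k = height u k := by
  rw [height, List.take_append_of_le_length h, height]

theorem height_take (w : List DyckStep) (j k : ℕ) :
    height (w.take k) j = height w (min j k) := by
  rw [height, List.take_take, height]

theorem height_succ_U (h : w[k]? = some U) : height w (k + 1) = height w k + 1 := by
  rw [height, height, count_take_succ_self h, count_take_succ_of_ne h (by decide)]
  push_cast
  ring

theorem height_succ_D (h : w[k]? = some D) : height w (k + 1) = height w k - 1 := by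
  rw [height, height, count_take_succ_self h, count_take_succ_of_ne h (by decide)]
  push_cast
  ring

theorem getElem?_eq_U_or_D (h : k < w.length) : w[k]? = some U ∨ w[k]? = some D := by
  rw [List.getElem?_eq_getElem h]
  simpa using w[k].dichotomy

theorem exists_dyckWord_iff : (∃ p : DyckWord, p.toList = w) ↔
    (∀ k, 0 ≤ height w k) ∧ height w w.length = 0 := by
  constructor
  · rintro ⟨p, rfl⟩
    exact ⟨fun k => sub_nonneg.2 (Nat.cast_le.2 (p.count_D_le_count_U k)),
      by rw [height_length, p.count_U_eq_count_D, sub_self]⟩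
  · rintro ⟨hnonneg, hend⟩
    rw [height_length] at hend
    exact ⟨⟨w, by omega, fun k => Nat.cast_le.1 (sub_nonneg.1 (hnonneg k))⟩, rfl⟩

theorem isDyckPath_iff : IsDyckPath n w ↔
    w.length = 2 * n ∧ (∀ k, 0 ≤ height w k) ∧ height w (2 * n) = 0 := by
  constructor
  · rintro ⟨p, rfl, rfl⟩
    rw [p.two_mul_semilength_eq_length]
    exact ⟨rfl, exists_dyckWord_iff.1 ⟨p, rfl⟩⟩
  · rintro ⟨hlen, h⟩
    obtain ⟨p, rfl⟩ := exists_dyckWord_iff.2 (hlen ▸ h)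
    have := p.two_mul_semilength_eq_length
    exact ⟨p, rfl, by omega⟩

namespace IsDyckPath

theorem length_eq (h : IsDyckPath n w) : w.length = 2 * n := (isDyckPath_iff.1 h).1

theorem height_nonneg (h : IsDyckPath n w) (k : ℕ) : 0 ≤ height w k := (isDyckPath_iff.1 h).2.1 k

theorem height_end (h : IsDyckPath n w) : height w (2 * n) = 0 := (isDyckPath_iff.1 h).2.2

theorem count_eq (h : IsDyckPath n w) (s : DyckStep) : w.count s = n := by
  obtain ⟨p, rfl, rfl⟩ := h
  cases s
  exacts [rfl, p.semilength_eq_count_D.symm]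

end IsDyckPath

/-- A tunnel of `w` from its step number `x` to its step number `y`, counted from `0`. -/
structure Tunnel (w : List DyckStep) (x y : ℕ) : Prop where
  lt : x < y
  left : w[x]? = some U
  right : w[y]? = some D
  height_eq : height w (y + 1) = height w x
  above : ∀ z, x < z → z ≤ y → height w x < height w z

theorem tunnel_append (A : List DyckStep) (B : DyckWord) (C : List DyckStep) :
    Tunnel (A ++ U :: (B.toList ++ D :: C)) A.length (A.length + 1 + B.toList.length) := by
  set w := A ++ U :: (B.toList ++ D :: C) with hw
  obtain ⟨hB, hB0⟩ := exists_dyckWord_iff.1 ⟨B, rfl⟩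
  have hleft : w[A.length]? = some U := by simp [hw]
  have hdrop : w.drop (A.length + 1) = B.toList ++ D :: C := by simp [hw]
  have hright : w[A.length + 1 + B.toList.length]? = some D := by
    rw [← List.getElem?_drop, hdrop]
    simp
  have hheight : ∀ k ≤ B.toList.length,
      height w (A.length + 1 + k) = height w A.length + 1 + height B.toList k := by
    intro k hk
    rw [height_add, height_succ_U hleft, hdrop, height_append_of_le hk]
  refine ⟨by omega, hleft, hright, ?_, fun z hz hz' => ?_⟩
  · rw [height_succ_D hright, hheight _ le_rfl, hB0]
    ring
  · obtain ⟨k, rfl⟩ := Nat.exists_eq_add_of_le (Nat.succ_le_of_lt hz)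
    rw [Nat.succ_eq_add_one, hheight k (by omega)]
    have := hB k
    omega

namespace Tunnel

theorem exists_eq_append (h : Tunnel w x y) : ∃ B : DyckWord,
    w = w.take x ++ U :: (B.toList ++ D :: w.drop (y + 1)) ∧
      w.take y = w.take x ++ U :: B.toList := by
  obtain ⟨m, rfl⟩ := Nat.exists_eq_add_of_le (Nat.succ_le_of_lt h.lt)
  set v := w.drop (x + 1) with hv
  have hright := h.right
  obtain ⟨hlt, hD⟩ := List.getElem?_eq_some_iff.1 hright
  have hlen : (v.take m).length = m := by
    rw [hv, List.length_take, List.length_drop]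
    omega
  have hheight : ∀ k ≤ m, height w (x + 1 + k) = height w x + 1 + height (v.take m) k := by
    intro k hk
    rw [height_add, height_succ_U h.left, ← hv, height_take, min_eq_left hk]
  obtain ⟨B, hB⟩ : ∃ B : DyckWord, B.toList = v.take m := by
    refine exists_dyckWord_iff.2 ⟨fun k => ?_, ?_⟩
    · have habove := h.above (x + 1 + min k m) (by omega) (by omega)
      rw [hheight _ (min_le_right _ _), height_take, min_assoc, min_self] at habove
      rw [height_take]
      omega
    · have hend := h.height_eq
      rw [height_succ_D hright, Nat.succ_eq_add_one, hheight m le_rfl] at hend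
      rw [hlen]
      omega
  have hx : w.take (x + 1) = w.take x ++ [U] := by rw [List.take_add_one, h.left]; rfl
  have htake : w.take (x.succ + m) = w.take x ++ U :: B.toList := by
    rw [List.take_add, Nat.succ_eq_add_one, hx, hB, List.append_assoc, List.singleton_append]
  refine ⟨B, ?_, htake⟩
  conv_lhs => rw [← List.take_append_drop (x.succ + m) w, htake, List.drop_eq_getElem_cons hlt, hD]
  simp

theorem right_unique (h : Tunnel w x y) (h' : Tunnel w x y') : y = y' := by
  wlog hlt : y < y' generalizing y y'
  · exact (not_lt.1 hlt).antisymm' (not_lt.1 fun hlt' => hlt'.ne' (this h' h hlt').symm)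
  have := h'.above (y + 1) (by have := h.lt; omega) hlt
  have := h.height_eq
  omega

theorem left_unique (h : Tunnel w x y) (h' : Tunnel w x' y) : x = x' := by
  wlog hlt : x < x' generalizing x x'
  · exact (not_lt.1 hlt).antisymm' (not_lt.1 fun hlt' => hlt'.ne' (this h' h hlt').symm)
  have := h.above x' hlt h'.lt.le
  have := h.height_eq
  have := h'.height_eq
  omega

theorem noncrossing (h : Tunnel w x y) (h' : Tunnel w x' y') (hx : x < x') :
    y < x' ∨ y' < y := by
  by_contra! hc
  rcases hc.2.lt_or_eq with hlt | rfl
  · have := h.above x' hx hc.1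
    have := h'.above (y + 1) (by omega) hlt
    have := h.height_eq
    omega
  · exact hx.ne (h.left_unique h')

end Tunnel

theorem isTunnel_iff : IsTunnel w a b ↔
    ∃ x y, Tunnel w x y ∧ (w.take x).count U = a ∧ (w.take y).count D = b := by
  constructor
  · rintro ⟨A, B, C, rfl, rfl, rfl⟩
    refine ⟨_, _, tunnel_append A B C, by simp, ?_⟩
    rw [← List.cons_append, ← List.append_assoc, List.take_left' (by simp; ring)]
  · rintro ⟨x, y, h, rfl, rfl⟩
    obtain ⟨B, hw, hy⟩ := h.exists_eq_append
    exact ⟨w.take x, B, w.drop (y + 1), hw, rfl, by rw [hy]⟩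

/-- The tunnel that starts at an up-step ends just before the first return to its height. -/
theorem IsDyckPath.exists_tunnel (h : IsDyckPath n w) (hx : w[x]? = some U) :
    ∃ y, Tunnel w x y := by
  obtain ⟨hlt, -⟩ := List.getElem?_eq_some_iff.1 hx
  rw [h.length_eq] at hlt
  have hex : ∃ k, x < k ∧ height w k ≤ height w x :=
    ⟨2 * n, hlt, by rw [h.height_end]; exact h.height_nonneg x⟩
  obtain ⟨hxk, hk⟩ := Nat.find_spec hex
  have hmin : ∀ z, x < z → z < Nat.find hex → height w x < height w z :=
    fun z hxz hz => not_le.1 fun hle => Nat.find_min hex hz ⟨hxz, hle⟩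
  have hkn : Nat.find hex ≤ 2 * n := Nat.find_min' hex
    ⟨hlt, by rw [h.height_end]; exact h.height_nonneg x⟩
  obtain ⟨y, hy⟩ : ∃ y, Nat.find hex = y + 1 := Nat.exists_eq_succ_of_ne_zero (by omega)
  rw [hy] at hxk hk hmin hkn
  have hxy : x < y := by
    refine (Nat.lt_succ_iff_lt_or_eq.1 hxk).resolve_right fun e => ?_
    have := height_succ_U hx
    rw [e] at this hk
    omega
  have hheight := hmin y hxy (Nat.lt_succ_self y)
  rcases getElem?_eq_U_or_D (w := w) (k := y) (by rw [h.length_eq]; omega) with hU | hD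
  · have := height_succ_U hU
    omega
  · have := height_succ_D hD
    exact ⟨y, hxy, hx, hD, by omega, fun z hxz hz => hmin z hxz (Nat.lt_succ_of_le hz)⟩

/-- The step numbers `x i` and `y i` of the ends of the tunnel that `Φ⁻¹` makes the entry `i` of
`π`. -/
structure TunnelEnds (w : List DyckStep) (π : Equiv.Perm (Fin n)) (x y : Fin n → ℕ) : Prop where
  tunnel : ∀ i, Tunnel w (x i) (y i)
  count_U : ∀ i, (w.take (x i)).count U = i.rev
  count_D : ∀ i, (w.take (y i)).count D = π i

theorem IsDyckPath.exists_tunnelEnds (h : IsDyckPath n w) :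
    ∃ (π : Equiv.Perm (Fin n)) (x y : Fin n → ℕ), TunnelEnds w π x y := by
  have htunnel : ∀ i : Fin n, ∃ x y, Tunnel w x y ∧ (w.take x).count U = i.rev := by
    intro i
    obtain ⟨x, hx, hc⟩ := exists_count_take_eq (w := w) (s := U) (a := i.rev)
      (by rw [h.count_eq]; exact i.rev.2)
    obtain ⟨y, hy⟩ := h.exists_tunnel hx
    exact ⟨x, y, hy, hc⟩
  choose x y hT hx using htunnel
  have hlt : ∀ i, (w.take (y i)).count D < n := by
    intro i
    have := (count_take_lt_iff (hT i).right).2 (List.getElem?_eq_some_iff.1 (hT i).right).1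
    rwa [List.take_length, h.count_eq] at this
  have hinj : Function.Injective fun i => (⟨_, hlt i⟩ : Fin n) := by
    intro i j hij
    have hy : y i = y j := eq_of_count_take_eq (hT i).right (hT j).right (Fin.ext_iff.1 hij)
    have hxij : x i = x j := (hT i).left_unique (hy ▸ hT j)
    exact Fin.rev_injective (Fin.ext (by rw [← hx i, ← hx j, hxij]))
  exact ⟨Equiv.ofBijective _ (Finite.injective_iff_bijective.1 hinj), x, y, hT, hx, fun _ => rfl⟩

namespace TunnelEnds

variable {π : Equiv.Perm (Fin n)} {x y x' y' : Fin n → ℕ} {w' : List DyckStep} {i j : Fin n}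

theorem isPhiInv (h : TunnelEnds w π x y) : IsPhiInv w π := by
  intro a b
  rw [isTunnel_iff]
  constructor
  · rintro rfl
    exact ⟨_, _, h.tunnel a.rev, by rw [h.count_U, Fin.rev_rev], h.count_D _⟩
  · rintro ⟨x', y', hT, hU, hD⟩
    obtain rfl : x' = x a.rev :=
      eq_of_count_take_eq hT.left (h.tunnel _).left (by rw [hU, h.count_U, Fin.rev_rev])
    obtain rfl := hT.right_unique (h.tunnel _)
    exact Fin.ext (by rw [← hD, h.count_D])

theorem left_lt_iff (h : TunnelEnds w π x y) (i : Fin n) :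
    x i < k ↔ (i.rev : ℕ) < (w.take k).count U := by
  rw [← h.count_U, count_take_lt_iff (h.tunnel i).left]

theorem right_lt_iff (h : TunnelEnds w π x y) (i : Fin n) :
    y i < k ↔ (π i : ℕ) < (w.take k).count D := by
  rw [← h.count_D, count_take_lt_iff (h.tunnel i).right]

theorem left_lt_left (h : TunnelEnds w π x y) : x i < x j ↔ j < i := by
  rw [h.left_lt_iff, h.count_U, ← Fin.lt_def, Fin.rev_lt_rev]

theorem right_lt_right (h : TunnelEnds w π x y) : y i < y j ↔ π i < π j := by
  rw [h.right_lt_iff, h.count_D, ← Fin.lt_def]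

theorem avoids (h : TunnelEnds w π x y) : Avoids p132 π := by
  refine avoids_p132_iff.2 fun a b c hab hbc hac hcb => ?_
  rw [← h.left_lt_left] at hab hbc
  rw [← h.right_lt_right] at hac hcb
  have := (h.tunnel a).lt
  have := (h.tunnel c).noncrossing (h.tunnel b) hbc
  omega

theorem left_add_right (h : TunnelEnds w π x y) (i : Fin n) :
    x i + y i = 2 * (i.rev + π i) + 1 := by
  have hT := h.tunnel i
  have hx := count_take_add (List.getElem?_eq_some_iff.1 hT.left).1.le
  have hy := count_take_add (List.getElem?_eq_some_iff.1 hT.right).1.le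
  have hheight := hT.height_eq
  rw [height_succ_D hT.right, height, height] at hheight
  rw [h.count_U] at hx hheight
  rw [h.count_D] at hy hheight
  omega

theorem lt_apply_iff (h : TunnelEnds w π x y) (i : Fin n) : i < π i ↔ 2 * n ≤ x i + y i := by
  rw [h.left_add_right, Fin.val_rev, Fin.lt_def]
  omega

theorem right_lt (h : TunnelEnds w π x y) (hw : IsDyckPath n w) (i : Fin n) : y i < 2 * n := by
  rw [← hw.length_eq]
  exact (List.getElem?_eq_some_iff.1 (h.tunnel i).right).1

theorem card_left_lt (h : TunnelEnds w π x y) (hw : IsDyckPath n w) (k : ℕ) :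
    #{i | x i < k} = (w.take k).count U := by
  simp only [h.left_lt_iff]
  exact (card_filter_apply (p := fun i : Fin n => (i : ℕ) < (w.take k).count U) Fin.revPerm).trans
    (card_filter_val_lt (hw.count_eq U ▸ (List.take_sublist k w).count_le U))

theorem card_right_lt (h : TunnelEnds w π x y) (hw : IsDyckPath n w) (k : ℕ) :
    #{i | y i < k} = (w.take k).count D := by
  simp only [h.right_lt_iff]
  exact (card_filter_apply (p := fun i : Fin n => (i : ℕ) < (w.take k).count D) π).trans
    (card_filter_val_lt (hw.count_eq D ▸ (List.take_sublist k w).count_le D))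

theorem card_add (h : TunnelEnds w π x y) (hw : IsDyckPath n w) (hk : k ≤ 2 * n) :
    #{i | x i < k} + #{i | y i < k} = k := by
  rw [h.card_left_lt hw, h.card_right_lt hw, count_take_add (by rwa [hw.length_eq])]

theorem exists_left (h : TunnelEnds w π x y) (hw : IsDyckPath n w) (hk : w[k]? = some U) :
    ∃ i, x i = k := by
  have hlt := (count_take_lt_iff hk).2 (List.getElem?_eq_some_iff.1 hk).1
  rw [List.take_length, hw.count_eq] at hlt
  refine ⟨Fin.rev ⟨_, hlt⟩, eq_of_count_take_eq (h.tunnel _).left hk ?_⟩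
  rw [h.count_U, Fin.rev_rev]

theorem exists_right (h : TunnelEnds w π x y) (hw : IsDyckPath n w) (hk : w[k]? = some D) :
    ∃ i, y i = k := by
  have hlt := (count_take_lt_iff hk).2 (List.getElem?_eq_some_iff.1 hk).1
  rw [List.take_length, hw.count_eq] at hlt
  refine ⟨π.symm ⟨_, hlt⟩, eq_of_count_take_eq (h.tunnel _).right hk ?_⟩
  rw [h.count_D, π.apply_symm_apply]

/-- By noncrossing, a tunnel starts before the end of the tunnel of `i` if and only if it also ends
before it or encloses the tunnel of `i`. -/
theorem right_eq (h : TunnelEnds w π x y) (hw : IsDyckPath n w) (i : Fin n) :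
    y i = 2 * π i + #{j | i ≤ j ∧ π i ≤ π j} := by
  have hcard : #{j | x j < y i} = #{j | y j < y i} + #{j | i ≤ j ∧ π i ≤ π j} := by
    refine card_filter_eq_add (fun j => ?_) (fun j => ?_)
    · have hj := (h.tunnel j).lt
      have hi := (h.tunnel i).lt
      rw [← not_lt, ← not_lt, ← h.left_lt_left, ← h.right_lt_right]
      refine ⟨fun hji => or_iff_not_imp_left.2 fun hy => ⟨fun hij => ?_, hy⟩, by omega⟩
      have := (h.tunnel i).noncrossing (h.tunnel j) hij
      omega
    · rw [h.right_lt_right]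
      grind
  have := h.card_add hw (h.right_lt hw i).le
  rw [hcard, h.card_right_lt hw, h.count_D] at this
  omega

theorem ends_eq (h : TunnelEnds w π x y) (hw : IsDyckPath n w) (h' : TunnelEnds w' π x' y')
    (hw' : IsDyckPath n w') : x = x' ∧ y = y' := by
  have hy : y = y' := funext fun i => by rw [h.right_eq hw, h'.right_eq hw']
  refine ⟨funext fun i => ?_, hy⟩
  have := h.left_add_right i
  have := h'.left_add_right i
  rw [← hy] at this
  omega

end TunnelEnds

end Tunnels

section Psi

variable {n : ℕ} {σ σ' π : Equiv.Perm (Fin n)} {x y : Fin n → ℕ} {t : Fin n} {j z : ℕ}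

theorem length_psi (σ : Equiv.Perm (Fin n)) : (psi σ).length = 2 * n := by
  simp [psi, two_mul]

theorem getElem?_psi_left (t : Fin n) :
    (psi σ)[(σ t : ℕ)]? = some (if IsBumped σ t then D else U) := by
  have hmem : (σ t : ℕ) ∈ (firstRows σ).1 ↔ ¬ IsBumped σ t := by
    rw [mem_firstRows_fst_iff, IsBumped, not_exists]
  rw [psi, List.getElem?_append_left (by simp)]
  simp [hmem, ite_not]

theorem getElem?_psi_right (t : Fin n) :
    (psi σ)[2 * n - 1 - (t : ℕ)]? = some (if IsBumper σ t then U else D) := by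
  have hmem : (t : ℕ) ∈ (firstRows σ).2 ↔ ¬ IsBumper σ t := by
    rw [mem_firstRows_snd_iff, IsBumper, not_exists]
  have hlt : 2 * n - 1 - (t : ℕ) - n < n := by omega
  have ht : n - 1 - (2 * n - 1 - (t : ℕ) - n) = t := by omega
  rw [psi, List.getElem?_append_right (by simp; omega), List.length_map, List.length_range,
    List.map_reverse, List.getElem?_reverse (by simpa using hlt)]
  simp [ht, hmem, ite_not]

theorem height_psi_left (hj : j ≤ n) : height (psi σ) j = heightL σ j := by
  induction j with
  | zero => simp [height, heightL]
  | succ j ih =>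
    obtain ⟨t, ht⟩ : ∃ t, σ t = ⟨j, hj⟩ := σ.surjective _
    obtain rfl : (σ t : ℕ) = j := by rw [ht]
    have hstep := getElem?_psi_left (σ := σ) t
    rw [heightL_succ]
    split_ifs at hstep ⊢
    · rw [height_succ_D hstep, ih (by omega), sub_eq_add_neg]
    · rw [height_succ_U hstep, ih (by omega)]

theorem height_psi_right (hj : j ≤ n) : height (psi σ) (2 * n - j) = heightR σ j := by
  induction hj using Nat.decreasingInduction with
  | self => rw [heightR_top, ← height_psi_left le_rfl, two_mul, Nat.add_sub_cancel]
  | of_succ j hj ih =>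
    have hstep := getElem?_psi_right (σ := σ) ⟨j, hj⟩
    have hR := heightR_succ (σ := σ) ⟨j, hj⟩
    dsimp only at hstep hR
    rw [show 2 * n - (j + 1) = 2 * n - 1 - j by omega] at ih
    rw [show 2 * n - j = 2 * n - 1 - j + 1 by omega]
    split_ifs at hstep hR
    · rw [height_succ_U hstep, ih, hR, neg_add_cancel_right]
    · rw [height_succ_D hstep, ih, hR, add_sub_cancel_right]

theorem floorHeight_le_height_psi (h : Avoids p321 σ) (hj : j ≤ z) (hz : z ≤ 2 * n - j) :
    floorHeight σ j ≤ height (psi σ) z := by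
  rcases le_total z n with hzn | hzn
  · rw [height_psi_left hzn]
    exact (Nat.cast_le.2 (floorHeight_mono σ hj)).trans (floorHeight_le_heightL h hzn)
  · rw [← Nat.sub_sub_self (hz.trans (Nat.sub_le _ _)), height_psi_right (by omega)]
    exact (Nat.cast_le.2 (floorHeight_mono σ (by omega))).trans
      (floorHeight_le_heightR h (by omega))

theorem isDyckPath_psi (h : Avoids p321 σ) : IsDyckPath n (psi σ) := by
  have hend : height (psi σ) (2 * n) = 0 := by
    simpa [heightR] using height_psi_right (σ := σ) (Nat.zero_le n)
  refine isDyckPath_iff.2 ⟨length_psi σ, fun z => ?_, hend⟩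
  rcases le_total z (2 * n) with hz | hz
  · exact (Nat.cast_nonneg _).trans (floorHeight_le_height_psi h z.zero_le hz)
  · rw [height, List.take_of_length_le (by rwa [length_psi]),
      ← List.take_of_length_le (length_psi σ).le, ← height, hend]

/-- The step of `psi σ` at which the tunnel matched to the entry `t` of `σ` is closed, when the
path is read alternately from its two ends. -/
def closingStep (σ : Equiv.Perm (Fin n)) (t : Fin n) : ℕ :=
  if t < σ t then σ t else 2 * n - 1 - t

theorem closingStep_injective (σ : Equiv.Perm (Fin n)) : Function.Injective (closingStep σ) := by
  intro s t hst
  unfold closingStep at hst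
  split_ifs at hst
  · exact σ.injective (Fin.ext hst)
  all_goals omega

theorem TunnelEnds.exists_closer_of_lt (hT : TunnelEnds (psi σ) π x y) (h : Avoids p321 σ)
    (ht : t < σ t) : ∃ i, (if i < π i then x i else y i) = σ t := by
  have hstep := getElem?_psi_left (σ := σ) t
  split_ifs at hstep with hb
  · obtain ⟨i, hi⟩ := hT.exists_right (isDyckPath_psi h) hstep
    have := (hT.tunnel i).lt
    exact ⟨i, by rw [if_neg (by rw [hT.lt_apply_iff]; omega), hi]⟩
  · obtain ⟨i, hi⟩ := hT.exists_left (isDyckPath_psi h) hstep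
    suffices hlt : i < π i from ⟨i, by rw [if_pos hlt, hi]⟩
    rw [hT.lt_apply_iff]
    by_contra! hlt
    have := (hT.tunnel i).lt
    have hheight := (hT.tunnel i).height_eq
    rw [hi, height_psi_left (σ t).2.le, heightL_eq_floorHeight h ht hb] at hheight
    obtain hz | hz : y i + 1 = 2 * n - σ t ∨ y i + 1 ≤ 2 * n - (σ t + 1) := by omega
    · rw [hz, height_psi_right (σ t).2.le] at hheight
      exact (floorHeight_lt_heightR h ht hb).ne' hheight
    · have := floorHeight_le_height_psi h (j := σ t + 1) (by omega) hz
      have := floorHeight_apply_succ ht hb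
      omega

theorem TunnelEnds.exists_closer_of_not_lt (hT : TunnelEnds (psi σ) π x y) (h : Avoids p321 σ)
    (ht : ¬ t < σ t) : ∃ i, (if i < π i then x i else y i) = 2 * n - 1 - t := by
  have hstep := getElem?_psi_right (σ := σ) t
  split_ifs at hstep with hb
  · obtain ⟨i, hi⟩ := hT.exists_left (isDyckPath_psi h) hstep
    have := (hT.tunnel i).lt
    exact ⟨i, by rw [if_pos ((hT.lt_apply_iff i).2 (by omega)), hi]⟩
  · obtain ⟨i, hi⟩ := hT.exists_right (isDyckPath_psi h) hstep
    suffices hlt : ¬ i < π i from ⟨i, by rw [if_neg hlt, hi]⟩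
    rw [hT.lt_apply_iff]
    intro hle
    have hheight := (hT.tunnel i).height_eq
    rw [hi, show 2 * n - 1 - (t : ℕ) + 1 = 2 * n - t by omega, height_psi_right t.2.le,
      heightR_eq_floorHeight h ht hb] at hheight
    have := (hT.tunnel i).lt
    have := floorHeight_le_height_psi h (j := t + 1) (z := x i) (by omega) (by omega)
    have := floorHeight_succ ht hb
    omega

/-- Counting: the `n` closing steps of `σ` are closing ends of tunnels, hence they are all of
them. -/
theorem TunnelEnds.exists_closingStep_eq (hT : TunnelEnds (psi σ) π x y) (h : Avoids p321 σ)
    (i : Fin n) : ∃ t, (if i < π i then x i else y i) = closingStep σ t := by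
  have hex : ∀ t, ∃ i, (if i < π i then x i else y i) = closingStep σ t := by
    intro t
    unfold closingStep
    split_ifs with ht
    exacts [hT.exists_closer_of_lt h ht, hT.exists_closer_of_not_lt h ht]
  choose f hf using hex
  have hinj : Function.Injective f := fun s t hst =>
    closingStep_injective σ (by rw [← hf s, ← hf t, hst])
  obtain ⟨t, rfl⟩ := Finite.injective_iff_surjective.1 hinj i
  exact ⟨t, hf t⟩

/-- The tunnel of the entry `g t` of `π` is matched to the entry `t` of `σ`: both entries are
excedances and the tunnel is opened at the down-step that records the position `t`, or none is and
the tunnel is opened at the up-step that records the value `σ t`. -/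
structure MatchesOpeners (σ π : Equiv.Perm (Fin n)) (x y : Fin n → ℕ)
    (g : Equiv.Perm (Fin n)) : Prop where
  lt_apply_iff : ∀ t, g t < π (g t) ↔ t < σ t
  right_eq : ∀ t, t < σ t → y (g t) = 2 * n - 1 - t
  left_eq : ∀ t, ¬ t < σ t → x (g t) = σ t

theorem TunnelEnds.exists_right_opener (hT : TunnelEnds (psi σ) π x y) (h : Avoids p321 σ)
    (ht : t < σ t) : ∃ i, y i = 2 * n - 1 - t ∧ i < π i := by
  have hstep := getElem?_psi_right (σ := σ) t
  rw [if_neg fun hb => (h.apply_lt_of_isBumper hb).not_gt ht] at hstep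
  obtain ⟨i, hi⟩ := hT.exists_right (isDyckPath_psi h) hstep
  refine ⟨i, hi, by_contra fun hlt => ?_⟩
  obtain ⟨s, hs⟩ := hT.exists_closingStep_eq h i
  rw [if_neg hlt, hi, closingStep] at hs
  grind

theorem TunnelEnds.exists_left_opener (hT : TunnelEnds (psi σ) π x y) (h : Avoids p321 σ)
    (ht : ¬ t < σ t) : ∃ i, x i = σ t ∧ ¬ i < π i := by
  have hstep := getElem?_psi_left (σ := σ) t
  rw [if_neg fun hb => ht (h.lt_apply_of_isBumped hb)] at hstep
  obtain ⟨i, hi⟩ := hT.exists_left (isDyckPath_psi h) hstep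
  refine ⟨i, hi, fun hlt => ?_⟩
  obtain ⟨s, hs⟩ := hT.exists_closingStep_eq h i
  rw [if_pos hlt, hi, closingStep] at hs
  split_ifs at hs with hs'
  · exact ht (σ.injective (Fin.ext hs) ▸ hs')
  · omega

theorem TunnelEnds.exists_matchesOpeners (hT : TunnelEnds (psi σ) π x y) (h : Avoids p321 σ) :
    ∃ g : Equiv.Perm (Fin n), MatchesOpeners σ π x y g := by
  have hex : ∀ t, ∃ i, (i < π i ↔ t < σ t) ∧
      (t < σ t → y i = 2 * n - 1 - t) ∧ (¬ t < σ t → x i = σ t) := by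
    intro t
    by_cases ht : t < σ t
    · obtain ⟨i, hi, hlt⟩ := hT.exists_right_opener h ht
      exact ⟨i, iff_of_true hlt ht, fun _ => hi, fun hn => absurd ht hn⟩
    · obtain ⟨i, hi, hlt⟩ := hT.exists_left_opener h ht
      exact ⟨i, iff_of_false hlt ht, fun hn => absurd hn ht, fun _ => hi⟩
  choose g hlt hy hx using hex
  have hinj : Function.Injective g := by
    intro s t hst
    have hiff : s < σ s ↔ t < σ t := by rw [← hlt s, ← hlt t, hst]
    by_cases ht : t < σ t
    · have := hy s (hiff.2 ht)
      have := hy t ht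
      rw [hst] at *
      omega
    · exact σ.injective (Fin.ext (by rw [← hx s (mt hiff.1 ht), ← hx t ht, hst]))
  exact ⟨Equiv.ofBijective g (Finite.injective_iff_bijective.1 hinj), hlt, hy, hx⟩

namespace MatchesOpeners

variable {g g' : Equiv.Perm (Fin n)}

theorem lt_apply_of_lt_apply (h : MatchesOpeners σ π x y g) (h' : MatchesOpeners σ' π x y g')
    (ht : t < σ t) : t < σ' t := by
  obtain ⟨s, hs⟩ := g'.surjective (g t)
  have hlt : s < σ' s := by rwa [← h'.lt_apply_iff, hs, h.lt_apply_iff]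
  have hts := h'.right_eq s hlt
  rw [hs, h.right_eq t ht] at hts
  obtain rfl : s = t := by omega
  exact hlt

theorem not_lt_of_not_lt (h : MatchesOpeners σ π x y g) (h' : MatchesOpeners σ' π x y g')
    {v : Fin n} (hv : ¬ σ.symm v < v) : ¬ σ'.symm v < v := by
  obtain ⟨t, rfl⟩ := σ.surjective v
  rw [σ.symm_apply_apply] at hv
  obtain ⟨s, hs⟩ := g'.surjective (g t)
  have hlt : ¬ s < σ' s := by rwa [← h'.lt_apply_iff, hs, h.lt_apply_iff]
  have hts := h'.left_eq s hlt
  rw [hs, h.left_eq t hv] at hts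
  rwa [Fin.ext hts, σ'.symm_apply_apply]

theorem eq (h : MatchesOpeners σ π x y g) (h' : MatchesOpeners σ' π x y g') (hσ : Avoids p321 σ)
    (hσ' : Avoids p321 σ') : σ = σ' :=
  hσ.ext_excedance hσ' (fun _ => ⟨h.lt_apply_of_lt_apply h', h'.lt_apply_of_lt_apply h⟩)
    fun _ => not_iff_not.1 ⟨h.not_lt_of_not_lt h', h'.not_lt_of_not_lt h⟩

end MatchesOpeners

theorem TunnelEnds.eq_of_psi {x' y' : Fin n → ℕ} (hT : TunnelEnds (psi σ) π x y)
    (hT' : TunnelEnds (psi σ') π x' y') (h : Avoids p321 σ) (h' : Avoids p321 σ') : σ = σ' := by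
  obtain ⟨rfl, rfl⟩ := hT.ends_eq (isDyckPath_psi h) hT' (isDyckPath_psi h')
  obtain ⟨g, hg⟩ := hT.exists_matchesOpeners h
  obtain ⟨g', hg'⟩ := hT'.exists_matchesOpeners h'
  exact hg.eq hg' h h'

end Psi

section Crossings

variable {n : ℕ} {σ π g : Equiv.Perm (Fin n)} {w : List DyckStep} {x y : Fin n → ℕ} {i j t : Fin n}

/-- The rank of a tunnel in the order in which the tunnels are opened when the steps of the path
are read alternately from its two ends. -/
def openTime (π : Equiv.Perm (Fin n)) (x y : Fin n → ℕ) (i : Fin n) : ℕ :=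
  if i < π i then 2 * (2 * n - 1 - y i) + 1 else 2 * x i

theorem sum_filter_sgn (π : Equiv.Perm (Fin n)) (p : Fin n → Prop) [DecidablePred p] :
    ∑ i with p i, sgn π i = (#{i | i < π i ∧ p i} : ℤ) - #{i | ¬ i < π i ∧ p i} := by
  simp only [card_filter, sum_filter, Nat.cast_sum, ← sum_sub_distrib, sgn]
  refine sum_congr rfl fun i _ => ?_
  split_ifs <;> simp_all

namespace TunnelEnds

theorem left_injective (h : TunnelEnds w π x y) : Function.Injective x := fun _ _ hij =>
  le_antisymm (not_lt.1 fun hlt => (h.left_lt_left.2 hlt).ne hij)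
    (not_lt.1 fun hlt => (h.left_lt_left.2 hlt).ne' hij)

theorem right_injective (h : TunnelEnds w π x y) : Function.Injective y := fun _ _ hij =>
  π.injective (le_antisymm (not_lt.1 fun hlt => (h.right_lt_right.2 hlt).ne' hij)
    (not_lt.1 fun hlt => (h.right_lt_right.2 hlt).ne hij))

theorem openTime_injective (h : TunnelEnds w π x y) (hw : IsDyckPath n w) :
    Function.Injective (openTime π x y) := by
  intro i j hij
  have := h.right_lt hw i
  have := h.right_lt hw j
  unfold openTime at hij
  split_ifs at hij
  · exact h.right_injective (by omega)
  · omega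
  · omega
  · exact h.left_injective (by omega)

theorem apply_lt_apply_iff_disjoint (h : TunnelEnds w π x y) (hij : i < j) :
    π j < π i ↔ y i < x j ∨ y j < x i := by
  rw [← h.right_lt_right]
  rw [← h.left_lt_left] at hij
  have := (h.tunnel i).lt
  have := (h.tunnel j).lt
  have := (h.tunnel j).noncrossing (h.tunnel i) hij
  omega

/-- The inversions of `π` are the pairs of disjoint tunnels, and their signs can be summed in the
order in which the tunnels are opened. -/
theorem crs_add_exc (h : TunnelEnds w π x y) (hw : IsDyckPath n w) :
    (crs π + exc π : ℤ) = -∑ j, sgn π j *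
      ∑ i with openTime π x y i < openTime π x y j ∧ (y i < x j ∨ y j < x i), sgn π i := by
  let F (p : Fin n × Fin n) : ℤ :=
    if y p.1 < x p.2 ∨ y p.2 < x p.1 then sgn π p.1 * sgn π p.2 else 0
  have hF (p) : F p.swap = F p := if_congr or_comm (mul_comm _ _) rfl
  rw [crs_add_exc_eq_neg_sum, neg_inj]
  calc ∑ p : Fin n × Fin n with p.1 < p.2, (if π p.2 < π p.1 then sgn π p.1 * sgn π p.2 else 0)
      = ∑ p with p.1 < p.2, F p := sum_congr rfl fun p hp =>
        if_congr (h.apply_lt_apply_iff_disjoint (mem_filter.1 hp).2) rfl rfl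
    _ = ∑ p with openTime π x y p.1 < openTime π x y p.2, F p :=
        sum_filter_lt_eq hF Function.injective_id (h.openTime_injective hw)
    _ = ∑ j, ∑ i with openTime π x y i < openTime π x y j, F (i, j) := by
        simp only [sum_filter, Fintype.sum_prod_type_right]
    _ = _ := by
        refine sum_congr rfl fun j _ => ?_
        simp only [F, mul_sum, sum_filter, ite_and, mul_ite, mul_zero, mul_comm]

theorem sum_sgn_of_not_lt (h : TunnelEnds w π x y) (hw : IsDyckPath n w) (hj : ¬ j < π j) :
    ∑ i with openTime π x y i < openTime π x y j ∧ (y i < x j ∨ y j < x i), sgn π i =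
      (#{i | 2 * n - x j ≤ y i ∧ x j ≤ x i} : ℤ) - #{i | y i < x j} := by
  rw [sum_filter_sgn]
  simp only [openTime, h.lt_apply_iff] at hj ⊢
  congr! 4 with i _ i _
  all_goals
    have := (h.tunnel i).lt
    have := (h.tunnel j).lt
    have := (h.tunnel i).noncrossing (h.tunnel j)
    have := (h.tunnel j).noncrossing (h.tunnel i)
    have := h.right_lt hw i
    have := h.right_lt hw j
    have := h.left_injective.eq_iff (a := i) (b := j)
    have : i = j → y i = y j := congrArg y
    grind

theorem sum_sgn_of_lt (h : TunnelEnds w π x y) (hw : IsDyckPath n w) (hj : j < π j)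
    (hy : y j = 2 * n - 1 - t) :
    ∑ i with openTime π x y i < openTime π x y j ∧ (y i < x j ∨ y j < x i), sgn π i =
      (#{i | 2 * n - t ≤ x i} : ℤ) - #{i | x i ≤ t ∧ y i < 2 * n - t} := by
  rw [sum_filter_sgn]
  simp only [openTime, h.lt_apply_iff] at hj ⊢
  congr! 4 with i _ i _
  all_goals
    have := (h.tunnel i).lt
    have := (h.tunnel j).lt
    have := (h.tunnel i).noncrossing (h.tunnel j)
    have := (h.tunnel j).noncrossing (h.tunnel i)
    have := h.right_lt hw i
    have := h.left_injective.eq_iff (a := i) (b := j)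
    have := h.right_injective.eq_iff (a := i) (b := j)
    grind

end TunnelEnds

namespace MatchesOpeners

theorem exc_eq (hg : MatchesOpeners σ π x y g) : exc π = exc σ :=
  (card_equiv g fun t => by simp [hg.lt_apply_iff]).symm

theorem cut_add_card (hg : MatchesOpeners σ π x y g) (h : TunnelEnds w π x y)
    (hw : IsDyckPath n w) {k : ℕ} (hk : k ≤ n) :
    cut σ k + #{i | y i < k} = #{i | 2 * n - k ≤ y i ∧ k ≤ x i} := by
  have hexc : #{t : Fin n | t < σ t ∧ (t : ℕ) < k} = #{i : Fin n | i < π i ∧ 2 * n - k ≤ y i} := by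
    refine card_equiv g fun t => ?_
    simp only [mem_filter, mem_univ, true_and, hg.lt_apply_iff]
    refine and_congr_right fun ht => ?_
    rw [hg.right_eq t ht]
    omega
  have hnonexc : #{t : Fin n | ¬ t < σ t ∧ (σ t : ℕ) < k} =
      #{i : Fin n | ¬ i < π i ∧ x i < k} := by
    refine card_equiv g fun t => ?_
    simp only [mem_filter, mem_univ, true_and, hg.lt_apply_iff]
    exact and_congr_right fun ht => by rw [hg.left_eq t ht]
  have hright : #{i : Fin n | i < π i ∧ 2 * n - k ≤ y i} =
      #{i | 2 * n - k ≤ y i ∧ k ≤ x i} + #{i : Fin n | i < π i ∧ x i < k} :=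
    card_filter_eq_add (fun i => by rw [h.lt_apply_iff]; omega) (by grind)
  have hleft : #{i | x i < k} =
      #{i : Fin n | i < π i ∧ x i < k} + #{i : Fin n | ¬ i < π i ∧ x i < k} :=
    card_filter_eq_add (by grind) (by grind)
  have := cut_add σ hk
  have := h.card_add hw (k := k) (by omega)
  omega

theorem cut_succ_add_card (hg : MatchesOpeners σ π x y g) (h : TunnelEnds w π x y)
    (hw : IsDyckPath n w) (ht : t < σ t) :
    cut σ (t + 1) + #{i | 2 * n - t ≤ x i} = #{i | x i ≤ t ∧ y i < 2 * n - t} := by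
  have hcut := hg.cut_add_card h hw (k := t + 1) t.2
  have hopener : #{i | 2 * n - (t + 1) ≤ y i ∧ t + 1 ≤ x i} =
      #{i | 2 * n - t ≤ y i ∧ t + 1 ≤ x i} + #{i | i = g t} := by
    refine card_filter_eq_add (fun i => ?_) (by grind [hg.right_eq t ht])
    have := (h.lt_apply_iff _).1 ((hg.lt_apply_iff t).2 ht)
    grind [hg.right_eq t ht, h.right_injective.eq_iff (a := i) (b := g t)]
  have hright : #{i | y i < 2 * n - t} =
      #{i | x i ≤ t ∧ y i < 2 * n - t} + #{i | t + 1 ≤ x i ∧ y i < 2 * n - t} :=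
    card_filter_eq_add (by grind) (by grind)
  have hleft : #{i | ¬ x i < t + 1} =
      #{i | 2 * n - t ≤ y i ∧ t + 1 ≤ x i} + #{i | t + 1 ≤ x i ∧ y i < 2 * n - t} :=
    card_filter_eq_add (by grind) (by grind)
  have hall (k : ℕ) : #{i | x i < k} + #{i | ¬ x i < k} = n := by
    rw [card_filter_add_card_filter_not, card_fin]
  have hlow := hall (t + 1)
  have hhigh := hall (2 * n - t)
  have := h.card_add hw (k := t + 1) (by omega)
  have := h.card_add hw (k := 2 * n - t) (by omega)
  simp only [filter_eq', mem_univ, if_true, card_singleton] at hopener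
  simp only [not_lt] at hleft hlow hhigh
  omega

theorem crs_add_exc (hg : MatchesOpeners σ π x y g) (h : TunnelEnds w π x y)
    (hw : IsDyckPath n w) : crs π + exc π = cutSum σ := by
  zify
  rw [h.crs_add_exc hw, ← Equiv.sum_comp g, ← sum_neg_distrib, cutSum, Nat.cast_sum]
  refine sum_congr rfl fun t _ => ?_
  split_ifs with ht
  · have hlt := (hg.lt_apply_iff t).2 ht
    have := hg.cut_succ_add_card h hw ht
    rw [h.sum_sgn_of_lt hw hlt (hg.right_eq t ht), sgn, if_pos hlt]
    omega
  · have hlt := mt (hg.lt_apply_iff t).1 ht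
    have := hg.cut_add_card h hw (σ t).2.le
    rw [h.sum_sgn_of_not_lt hw hlt, sgn, if_neg hlt, hg.left_eq t ht]
    omega

end MatchesOpeners

theorem TunnelEnds.crs_eq_of_psi (hT : TunnelEnds (psi σ) π x y) (h : Avoids p321 σ) :
    crs π = crs σ := by
  obtain ⟨g, hg⟩ := hT.exists_matchesOpeners h
  have := hg.crs_add_exc hT (isDyckPath_psi h)
  have := hg.exc_eq
  have := h.crs_add_exc
  omega

end Crossings

end ElizaldePak

theorem mainTheorem2 (n : ℕ) :
    ∃ Θ : ElizaldePak.Av n ElizaldePak.p321 ≃ ElizaldePak.Av n ElizaldePak.p132,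
      ElizaldePak.IsElizaldePakMap Θ ∧
      ∀ σ : ElizaldePak.Av n ElizaldePak.p321,
        ElizaldePak.crs (Θ σ).1 = ElizaldePak.crs σ.1 := by
  open ElizaldePak in
  have hpsi (σ : Av n p321) := isDyckPath_psi σ.2
  choose π x y hT using fun σ : Av n p321 => (hpsi σ).exists_tunnelEnds
  let Θ (σ : Av n p321) : Av n p132 := ⟨π σ, (hT σ).avoids⟩
  have hΘ : Function.Injective Θ := fun σ σ' hσ => by
    have hπ : π σ = π σ' := congrArg Subtype.val hσ
    exact Subtype.ext ((hT σ).eq_of_psi (hπ ▸ hT σ') σ.2 σ'.2)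
  have hcard : Nat.card (Av n p321) = Nat.card (Av n p132) :=
    le_antisymm (Nat.card_le_card_of_injective Θ hΘ) (card_av_p132_le n)
  exact ⟨Equiv.ofBijective Θ ((Nat.bijective_iff_injective_and_card Θ).2 ⟨hΘ, hcard⟩),
    fun σ => ⟨hpsi σ, (hT σ).isPhiInv⟩, fun σ => (hT σ).crs_eq_of_psi σ.2⟩
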